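/- Let $\mathfrak g$ be a finite-dimensional complex simple Lie algebra, $\mathfrak t$ a Cartan subalgebra, $\Delta$ the root system of $(\mathfrak g,\mathfrak t)$ with root spaces $\mathfrak g_\gamma$, $\Pi$ a set of simple roots, $\Delta^+$ the corresponding positive roots, $\theta$ the highest root, and $\mathfrak b=\mathfrak t\oplus\bigoplus_{\gamma\in\Delta^+}\mathfrak g_\gamma$. An abelian ideal of $\mathfrak b$ is a subspace $\mathfrak a\subset\mathfrak b$ with $[\mathfrak b,\mathfrak a]\subset\mathfrak a$ and $[\mathfrak a,\mathfrak a]=0$; put $I_{\mathfrak a}=\{\gamma\in\Delta^+\mid\mathfrak g_\gamma\subset\mathfrak a\}$. Let $V$ be the real span of $\Delta$ with its Weyl-invariant inner product $(\,,)$, and extend $(\,,)$ to $\widehat V=V\oplus\mathbb R\delta\oplus\mathbb R\lambda$ by $(\delta,V)=(\lambda,V)=(\delta,\delta)=(\lambda,\lambda)=0$ and $(\delta,\lambda)=1$. Put $\alpha_0=\delta-\theta$. The affine Weyl group $\widehat W\subset GL(\widehat V)$ is generated by the reflections in the elements of $\Pi\cup\{\alpha_0\}$. Put $\widehat\Delta^+=\Delta^+\cup\{\gamma+k\delta\mid\gamma\in\Delta,\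 k\in\mathbb Z,\ k\ge1\}$ and $\mathcal N(w)=\{\nu\in\widehat\Delta^+\mid w(\nu)\in-\widehat\Delta^+\}$ for $w\in\widehat W$. The minuscule element of an abelian ideal $\mathfrak a$ is the unique $w_{\mathfrak a}\in\widehat W$ with $\mathcal N(w_{\mathfrak a})=\{\delta-\gamma\mid\gamma\in I_{\mathfrak a}\}$, and the rootlet of a nonzero abelian ideal $\mathfrak a$ is $\tau(\mathfrak a)=w_{\mathfrak a}(\alpha_0)+\delta$, which is a long positive root. (If all roots have the same length, all are called long.) Let $\tilde\alpha\in\Pi$ be a long simple root, and let $\mathfrak a(\tilde\alpha)_{\min}$ and $\mathfrak a(\tilde\alpha)_{\max}$ be the (unique) minimal and the (unique) maximal element, with respect to inclusion, of the set of nonzero abelian ideals of $\mathfrak b$ with rootlet $\tilde\alpha$. Write $I(\tilde\alpha)_{\min}$, $I(\tilde\alpha)_{\max}$ for their sets of roots and $\mathfrak p[\tilde\alpha]_{\min}$, $\mathfrak p[\tilde\alpha]_{\max}$ for their normalisers in $\mathfrak g$, where the normaliser of $\mathfrak a$ is $\{x\in\mathfrak g\mid[x,\mathfrak a]\subset\mathfrak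 a\}$. If $I(\tilde\alpha)_{\min}\ne I(\tilde\alpha)_{\max}$, then $\mathfrak p[\tilde\alpha]_{\min}\ne\mathfrak p[\tilde\alpha]_{\max}$. -/

import Mathlib

namespace AbelianIdealNormaliser

open RootPairing Module

noncomputable section

/-! ### Root-system notions

`P` is a finite crystallographic root system over `ℂ` and `b` a base of it. The real vector space
`V` is the real span of the roots, with the Weyl-invariant inner product
`(x, y) = ∑ γ, ⟨x, γ^∨⟩ ⟨y, γ^∨⟩`. -/

section Roots

variable {ι M N : Type*} [Fintype ι] [AddCommGroup M] [Module ℂ M] [AddCommGroup N] [Module ℂ N]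

instance (P : RootPairing ι ℂ M N) [P.IsCrystallographic] : P.IsValuedIn ℝ :=
  IsValuedIn.trans P ℝ ℤ

/-- The root `γ` is long: no root has greater length (so all roots are long if there is only one
root length). -/
def IsLong (P : RootPairing ι ℂ M N) [P.IsCrystallographic] (γ : ι) : Prop :=
  ∀ β : ι, P.RootFormIn ℝ (P.rootSpanMem ℝ β) (P.rootSpanMem ℝ β) ≤
    P.RootFormIn ℝ (P.rootSpanMem ℝ γ) (P.rootSpanMem ℝ γ)

variable {P : RootPairing ι ℂ M N}

/-- The usual order on roots: `γ - β` is a nonnegative integral combination of simple roots. -/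
def RootLE (b : P.Base) (β γ : ι) : Prop :=
  P.root γ - P.root β ∈ AddSubmonoid.closure (P.root '' b.support)

/-- `θ` is the highest root, i.e. the largest root for the usual order. -/
def IsHighestRoot (b : P.Base) (θ : ι) : Prop :=
  ∀ γ : ι, RootLE b γ θ

/-! ### The affine root system and the affine Weyl group -/

variable (P)

/-- The space `V ⊕ ℝδ ⊕ ℝλ`; the triple `(v, s, t)` stands for `v + s δ + t λ`. -/
abbrev AffineSpan : Type _ := P.rootSpan ℝ × ℝ × ℝ

/-- The element `δ`. -/
def delta : AffineSpan P := (0, 1, 0)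

/-- A root as an element of `V ⊕ ℝδ ⊕ ℝλ`. -/
def ofRoot (γ : ι) : AffineSpan P := (P.rootSpanMem ℝ γ, 0, 0)

/-- The extension of the inner product of `V` with `(δ, V) = (λ, V) = (δ, δ) = (λ, λ) = 0` and
`(δ, λ) = 1`. -/
def affineForm [P.IsCrystallographic] : LinearMap.BilinForm ℝ (AffineSpan P) :=
  LinearMap.mk₂ ℝ (fun x y => P.RootFormIn ℝ x.1 y.1 + (x.2.1 * y.2.2 + x.2.2 * y.2.1))
    (fun x x' y => by simp; ring) (fun c x y => by simp; ring)
    (fun x y y' => by simp; ring) (fun c x y => by simp; ring)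

/-- The coroot `2 x / (x, x)` of a non-isotropic vector. -/
def affineCoroot [P.IsCrystallographic] (x : AffineSpan P) : AffineSpan P :=
  (2 / affineForm P x x) • x

/-- The reflection `x ↦ x - (x, a) a^∨` in a non-isotropic vector `a`. -/
def affineReflection [P.IsCrystallographic] (a : AffineSpan P) (ha : affineForm P a a ≠ 0) :
    AffineSpan P ≃ₗ[ℝ] AffineSpan P :=
  Module.reflection (x := affineCoroot P a) (f := (affineForm P).flip a)
    (by simp [affineCoroot, ha])

theorem affineReflection_apply [P.IsCrystallographic] (a : AffineSpan P)
    (ha : affineForm P a a ≠ 0) (x : AffineSpan P) :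
    affineReflection P a ha x = x - affineForm P x a • affineCoroot P a := by
  simp [affineReflection, Module.reflection_apply]

variable {P}

/-- The affine simple roots: `none` is `α₀ = δ - θ`, and `some i` is the simple root `i`. -/
def affineSimpleRoot (b : P.Base) (θ : ι) : Option b.support → AffineSpan P
  | none => delta P - ofRoot P θ
  | some i => ofRoot P i

theorem affineForm_ofRoot_self_ne_zero [P.IsCrystallographic] (γ : ι) :
    affineForm P (ofRoot P γ) (ofRoot P γ) ≠ 0 := by
  have h := (P.posRootForm ℝ).zero_lt_posForm_apply_root γ
    (Submodule.subset_span (Set.mem_range_self γ))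
  rw [posRootForm_eq] at h
  simpa [affineForm, ofRoot] using h.ne'

theorem affineForm_affineSimpleRoot_self_ne_zero [P.IsCrystallographic] (b : P.Base) (θ : ι)
    (i : Option b.support) :
    affineForm P (affineSimpleRoot b θ i) (affineSimpleRoot b θ i) ≠ 0 := by
  cases i with
  | none =>
    have h := affineForm_ofRoot_self_ne_zero (P := P) θ
    simpa [affineSimpleRoot, affineForm, ofRoot, delta] using h
  | some i => exact affineForm_ofRoot_self_ne_zero _

/-- The affine simple reflections `s₀, s₁, …, sₙ`. -/
def affineSimpleReflection [P.IsCrystallographic] (b : P.Base) (θ : ι) (i : Option b.support) :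
    AffineSpan P ≃ₗ[ℝ] AffineSpan P :=
  affineReflection P (affineSimpleRoot b θ i) (affineForm_affineSimpleRoot_self_ne_zero b θ i)

/-- The affine Weyl group: the subgroup of the general linear group of `V ⊕ ℝδ ⊕ ℝλ` generated by
the affine simple reflections. -/
def affineWeylGroup [P.IsCrystallographic] (b : P.Base) (θ : ι) :
    Subgroup (AffineSpan P ≃ₗ[ℝ] AffineSpan P) :=
  Subgroup.closure (Set.range (affineSimpleReflection b θ))

/-- The positive affine roots: the positive roots, and all `γ + k δ` with `γ` a root, `k ≥ 1`. -/
def positiveAffineRoots (b : P.Base) : Set (AffineSpan P) :=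
  {x | ∃ γ : ι, b.IsPos γ ∧ x = ofRoot P γ} ∪
    {x | ∃ γ : ι, ∃ k : ℤ, 1 ≤ k ∧ x = ofRoot P γ + k • delta P}

/-- The inversion set of `w`: the positive affine roots that `w` sends to negative ones. -/
def inversionSet (b : P.Base) (w : AffineSpan P ≃ₗ[ℝ] AffineSpan P) : Set (AffineSpan P) :=
  {ν | ν ∈ positiveAffineRoots b ∧ -(w ν) ∈ positiveAffineRoots b}

/-- `w` is a minuscule element of the affine Weyl group with set of roots `I_w = I`, i.e. its
inversion set is `{δ - γ | γ ∈ I}`. -/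
def IsMinusculeWith [P.IsCrystallographic] (b : P.Base) (θ : ι) (I : Set ι)
    (w : AffineSpan P ≃ₗ[ℝ] AffineSpan P) : Prop :=
  w ∈ affineWeylGroup b θ ∧ inversionSet b w = (fun γ => delta P - ofRoot P γ) '' I

end Roots

/-! ### Abelian ideals of a Borel subalgebra

`L` is a simple complex Lie algebra, `H` a Cartan subalgebra, and `b` a base of the root system. -/

section Lie

variable {L : Type*} [LieRing L] [LieAlgebra ℂ L]

/-- The normaliser `{x ∈ L | ⁅x, a⁆ ⊆ a}` of a subspace `a`. -/
def subspaceNormaliser (a : Submodule ℂ L) : LieSubalgebra ℂ L where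
  carrier := {x | ∀ y ∈ a, ⁅x, y⁆ ∈ a}
  add_mem' := fun hx hx' y hy => by
    rw [add_lie]
    exact a.add_mem (hx y hy) (hx' y hy)
  zero_mem' := fun y _ => by simp
  smul_mem' := fun c x hx y hy => by
    rw [smul_lie]
    exact a.smul_mem c (hx y hy)
  lie_mem' := fun {x x'} hx hx' y hy => by
    rw [lie_lie]
    exact a.sub_mem (hx _ (hx' y hy)) (hx' _ (hx y hy))

variable [FiniteDimensional ℂ L] [LieAlgebra.IsSimple ℂ L]
  {H : LieSubalgebra ℂ L} [H.IsCartanSubalgebra]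

/-- The standard Borel subalgebra: the sum of the Cartan subalgebra and of the root spaces of the
positive roots. -/
def borel (b : (LieAlgebra.IsKilling.rootSystem H).Base) : Submodule ℂ L :=
  H.toSubmodule ⊔ ⨆ γ : {γ : H.root // b.IsPos γ}, (LieAlgebra.rootSpace H γ.1.1).toSubmodule

/-- Abelian ideals of the Borel subalgebra, as subspaces of `L`. -/
structure IsAbelianIdeal (b : (LieAlgebra.IsKilling.rootSystem H).Base) (a : Submodule ℂ L) :
    Prop where
  le_borel : a ≤ borel b
  lie_mem : ∀ x ∈ borel b, ∀ y ∈ a, ⁅x, y⁆ ∈ a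
  lie_eq_zero : ∀ x ∈ a, ∀ y ∈ a, ⁅x, y⁆ = 0

/-- The set `I_a` of the positive roots whose root space lies in `a`. -/
def rootsOf (b : (LieAlgebra.IsKilling.rootSystem H).Base) (a : Submodule ℂ L) : Set H.root :=
  {γ | b.IsPos γ ∧ (LieAlgebra.rootSpace H γ.1).toSubmodule ≤ a}

/-- The root `μ` is the rootlet `w_a(α₀) + δ` of `a`, where `w_a` is the minuscule element
corresponding to `a`. -/
def IsRootlet (b : (LieAlgebra.IsKilling.rootSystem H).Base) (θ : H.root) (a : Submodule ℂ L)
    (μ : H.root) : Prop :=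
  ∃ w, IsMinusculeWith b θ (rootsOf b a) w ∧
    w (affineSimpleRoot b θ none) + delta _ = ofRoot (LieAlgebra.IsKilling.rootSystem H) μ

/-- The set of the nonzero abelian ideals of the Borel subalgebra with rootlet `μ`. -/
def rootletFibre (b : (LieAlgebra.IsKilling.rootSystem H).Base) (θ μ : H.root) :
    Set (Submodule ℂ L) :=
  {a | IsAbelianIdeal b a ∧ a ≠ ⊥ ∧ IsRootlet b θ a μ}

end Lie

end

end AbelianIdealNormaliser

/-! Write `α` for the simple rootlet, `w` for the minuscule element of an ideal `a` with root set
`I`, and `α_i` for the affine simple roots. Two facts combine.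

First, for a simple root `β` the space `g_{-β}` normalises `a` exactly when `w(β)` is an affine
simple root. On roots, normalising means that `β ∉ I` and that `I` is stable under subtracting `β`.
Since the inversions of `w` are the `δ - γ` with `γ ∈ I`, this stability expresses indecomposability
of `w(β)` among positive affine roots (`notMem_of_apply_simple`, `sub_mem_of_apply_simple`,
`exists_apply_simple`). So it suffices to find a simple `β` that only the minuscule element of the
maximal ideal sends to an affine simple root.

Second, `w⁻¹(α) = 2δ - θ`, so if `w⁻¹(α_i) = γ + kδ`, then `α_i ⊥ α` iff `γ ⊥ θ`. When `α_i ⊥ α`,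
passing from `w` to `s_i w` keeps the rootlet and adds or removes a single root where `k = ±1`
permits. The level of `(w s₀)⁻¹(α_i)` is `k + ⟨γ, θ^∨⟩`. If `I` is minimal, no removal is possible,
and this forces `w s₀` to preserve levels (`level_mul_none_of_minimal`). Then `k + ⟨γ, θ^∨⟩` is the
level of `α_i`, and the minimal element is unique (`eq_of_minimal`).

If `α₀` is not orthogonal to `α`, these level equations show that nothing lies strictly above the
minimal set, so the two ideals have the same roots (`eq_of_minimal_of_subset`). If `α₀ ⊥ α`, no
addition is possible at a maximal set, which yields a simple `β` with `⟨β, θ^∨⟩ > 0` whose image is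
affine simple (`exists_simple_of_maximal`). For the minimal set such a `β` cannot have image `α_i`:
the level equation would give `i = 0`, whereas `α₀ ⊥ α` would give `β ⊥ θ`. -/

set_option linter.unusedSectionVars false

namespace AbelianIdealNormaliser

open RootPairing Module

section AffineRoots

variable {ι M N : Type*} [AddCommGroup M] [Module ℂ M] [AddCommGroup N] [Module ℂ N]
  {P : RootPairing ι ℂ M N}

/-! ### Affine roots -/

variable (P) in
/-- The affine root `γ + k δ`. -/
noncomputable def affRoot (γ : ι) (k : ℤ) : AffineSpan P := ofRoot P γ + k • delta P

@[simp] theorem affRoot_fst (γ : ι) (k : ℤ) : (affRoot P γ k).1 = P.rootSpanMem ℝ γ := by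
  simp [affRoot, ofRoot, delta]

@[simp] theorem affRoot_snd_fst (γ : ι) (k : ℤ) : (affRoot P γ k).2.1 = k := by
  simp [affRoot, ofRoot, delta]

@[simp] theorem affRoot_snd_snd (γ : ι) (k : ℤ) : (affRoot P γ k).2.2 = 0 := by
  simp [affRoot, ofRoot, delta]

theorem ofRoot_eq (γ : ι) : ofRoot P γ = affRoot P γ 0 := by simp [affRoot]

theorem affRoot_ext_iff {γ γ' : ι} {k k' : ℤ} :
    affRoot P γ k = affRoot P γ' k' ↔ γ = γ' ∧ k = k' := by
  refine ⟨fun h => ?_, fun h => by rw [h.1, h.2]⟩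
  have h1 := congrArg (fun x : AffineSpan P => (x.1 : M)) h
  have h2 := congrArg (fun x : AffineSpan P => x.2.1) h
  simp at h1 h2
  exact ⟨h1, h2⟩

theorem affRoot_add_of_root_eq {α β γ : ι} (h : P.root γ = P.root α + P.root β) (k l : ℤ) :
    affRoot P γ (k + l) = affRoot P α k + affRoot P β l := by
  refine Prod.ext (Subtype.ext ?_) (Prod.ext ?_ ?_) <;> simp [h]

theorem neg_affRoot (γ : ι) (k : ℤ) :
    -affRoot P γ k = affRoot P (P.reflectionPerm γ γ) (-k) := by
  refine Prod.ext (Subtype.ext ?_) (Prod.ext ?_ ?_) <;> simp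

theorem root_neg_index (γ : ι) : P.root (P.reflectionPerm γ γ) = -P.root γ := by simp

theorem neg_neg_index (γ : ι) :
    P.reflectionPerm (P.reflectionPerm γ γ) (P.reflectionPerm γ γ) = γ :=
  P.root.injective (by rw [root_neg_index, root_neg_index, neg_neg])

theorem affRoot_ne_zero (γ : ι) (k : ℤ) : affRoot P γ k ≠ 0 := by
  intro h
  have h1 := congrArg (fun x : AffineSpan P => (x.1 : M)) h
  simp [P.ne_zero] at h1

variable (P) in
/-- The set of the real affine roots. -/
def affineRoots : Set (AffineSpan P) := {x | ∃ γ k, x = affRoot P γ k}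

theorem affRoot_mem (γ : ι) (k : ℤ) : affRoot P γ k ∈ affineRoots P := ⟨γ, k, rfl⟩

theorem neg_mem_affineRoots {x : AffineSpan P} (h : x ∈ affineRoots P) : -x ∈ affineRoots P := by
  obtain ⟨γ, k, rfl⟩ := h
  rw [neg_affRoot]
  exact affRoot_mem _ _

theorem isPos_neg_iff (b : P.Base) (γ : ι) : b.IsPos (P.reflectionPerm γ γ) ↔ ¬ b.IsPos γ :=
  Base.IsPos.neg_iff_not b γ

theorem height_neg (b : P.Base) (γ : ι) : b.height (P.reflectionPerm γ γ) = - b.height γ :=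
  b.height_reflectionPerm_self γ

theorem affRoot_mem_pos_iff (b : P.Base) {γ : ι} {k : ℤ} :
    affRoot P γ k ∈ positiveAffineRoots b ↔ 1 ≤ k ∨ (k = 0 ∧ b.IsPos γ) := by
  constructor
  · rintro (⟨β, hβ, h⟩ | ⟨β, l, hl, h⟩)
    · rw [ofRoot_eq, affRoot_ext_iff] at h
      exact .inr ⟨h.2, h.1 ▸ hβ⟩
    · change _ = affRoot P β l at h
      rw [affRoot_ext_iff] at h
      exact .inl (h.2 ▸ hl)
  · rintro (h | ⟨rfl, h⟩)
    · exact .inr ⟨γ, k, h, rfl⟩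
    · exact .inl ⟨γ, h, (ofRoot_eq γ).symm⟩

theorem pos_subset (b : P.Base) : positiveAffineRoots b ⊆ affineRoots P := by
  rintro x (⟨β, -, rfl⟩ | ⟨β, l, -, rfl⟩)
  · exact ⟨β, 0, ofRoot_eq β⟩
  · exact ⟨β, l, rfl⟩

theorem pos_or_neg_pos (b : P.Base) {x : AffineSpan P} (h : x ∈ affineRoots P) :
    x ∈ positiveAffineRoots b ∨ -x ∈ positiveAffineRoots b := by
  obtain ⟨γ, k, rfl⟩ := h
  rw [neg_affRoot, affRoot_mem_pos_iff, affRoot_mem_pos_iff, isPos_neg_iff]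
  by_cases hp : b.IsPos γ <;> simp only [hp, not_true, not_false_iff, and_true, and_false, or_false] <;> omega

theorem not_neg_pos (b : P.Base) {x : AffineSpan P} (h : x ∈ positiveAffineRoots b) :
    -x ∉ positiveAffineRoots b := by
  obtain ⟨γ, k, rfl⟩ := pos_subset b h
  rw [affRoot_mem_pos_iff] at h
  rw [neg_affRoot, affRoot_mem_pos_iff, isPos_neg_iff]
  by_cases hp : b.IsPos γ <;> simp only [hp, not_true, not_false_iff, and_true, and_false, or_false] at h ⊢ <;> omega

theorem neg_pos_iff (b : P.Base) {x : AffineSpan P} (h : x ∈ affineRoots P) :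
    -x ∈ positiveAffineRoots b ↔ x ∉ positiveAffineRoots b :=
  ⟨fun h' h'' => not_neg_pos b h'' h', (pos_or_neg_pos b h).resolve_left⟩

/-! ### The cone of the affine simple roots -/

/-- The nonnegative integral combinations of the affine simple roots. -/
def simpleCone (b : P.Base) (θ : ι) : AddSubmonoid (AffineSpan P) :=
  AddSubmonoid.closure (Set.range (affineSimpleRoot b θ))

theorem simple_mem_cone (b : P.Base) (θ : ι) (i) : affineSimpleRoot b θ i ∈ simpleCone b θ :=
  AddSubmonoid.subset_closure ⟨i, rfl⟩

theorem affineSimpleRoot_none (b : P.Base) (θ : ι) :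
    affineSimpleRoot b θ none = affRoot P (P.reflectionPerm θ θ) 1 := by
  refine Prod.ext (Subtype.ext ?_) (Prod.ext ?_ ?_) <;> simp [affineSimpleRoot, ofRoot, delta]

theorem affineSimpleRoot_some (b : P.Base) (θ : ι) (i : b.support) :
    affineSimpleRoot b θ (some i) = affRoot P i 0 := ofRoot_eq _

theorem simple_mem_affineRoots (b : P.Base) (θ : ι) (i) :
    affineSimpleRoot b θ i ∈ affineRoots P := by
  cases i with
  | none => exact ⟨_, _, affineSimpleRoot_none b θ⟩
  | some i => exact ⟨_, _, affineSimpleRoot_some b θ i⟩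

theorem simple_pos (b : P.Base) (θ : ι) (i) :
    affineSimpleRoot b θ i ∈ positiveAffineRoots b := by
  cases i with
  | none => rw [affineSimpleRoot_none, affRoot_mem_pos_iff]; simp
  | some i =>
    rw [affineSimpleRoot_some, affRoot_mem_pos_iff]
    exact .inr ⟨rfl, Base.isPos_of_mem_support i.2⟩

theorem exists_mem_of_mem_closure (b : P.Base) {S : AddSubmonoid (AffineSpan P)}
    (hS : ∀ i ∈ b.support, affRoot P i 0 ∈ S) {y : M}
    (hy : y ∈ AddSubmonoid.closure (P.root '' b.support)) :
    ∃ x ∈ S, (x.1 : M) = y ∧ x.2 = 0 := by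
  induction hy using AddSubmonoid.closure_induction with
  | mem y hy =>
    obtain ⟨i, hi, rfl⟩ := hy
    exact ⟨_, hS i hi, by simp, by ext <;> simp⟩
  | zero => exact ⟨0, zero_mem _, by simp, rfl⟩
  | add y z _ _ hy hz =>
    obtain ⟨y', h1, h2, h3⟩ := hy
    obtain ⟨z', h4, h5, h6⟩ := hz
    exact ⟨y' + z', add_mem h1 h4, by simp [h2, h5], by simp [h3, h6]⟩

/-- The submonoid `S` is arbitrary so that it can also be the preimage of `simpleCone` under a Weyl
group element that keeps the finite positive roots positive. -/
theorem sub_mem_of_rootLE (b : P.Base) {S : AddSubmonoid (AffineSpan P)}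
    (hS : ∀ i ∈ b.support, affRoot P i 0 ∈ S) {β γ : ι} (h : RootLE b β γ) (k : ℤ) :
    affRoot P γ k - affRoot P β k ∈ S := by
  obtain ⟨x, hx, h1, h2⟩ := exists_mem_of_mem_closure b hS h
  convert hx using 1
  refine Prod.ext (Subtype.ext ?_) (Prod.ext ?_ ?_) <;> simp [h1, h2]

theorem support_mem_cone (b : P.Base) (θ : ι) (i : ι) (hi : i ∈ b.support) :
    affRoot P i 0 ∈ simpleCone b θ := by
  rw [← ofRoot_eq]
  exact simple_mem_cone b θ (some ⟨i, hi⟩)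

theorem sub_mem_cone_of_rootLE (b : P.Base) (θ : ι) {β γ : ι} (h : RootLE b β γ) (k : ℤ) :
    affRoot P γ k - affRoot P β k ∈ simpleCone b θ :=
  sub_mem_of_rootLE b (support_mem_cone b θ) h k

theorem delta_eq (b : P.Base) (θ : ι) :
    delta P = affineSimpleRoot b θ none + affRoot P θ 0 := by
  rw [← ofRoot_eq]; simp [affineSimpleRoot]

/-! ### Affine height and positivity -/

section Height

variable [P.IsRootSystem]

/-- The linear extension of the height of roots to `V ⊕ ℝδ ⊕ ℝλ` taking the value `1` on every
affine simple root. -/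
noncomputable def affineHeight (b : P.Base) (θ : ι) : AffineSpan P →ₗ[ℝ] ℝ :=
  ((Complex.reLm.comp ((b.toWeightBasis.constr ℂ (fun _ => (1 : ℂ))).restrictScalars ℝ)).comp
    (P.rootSpan ℝ).subtype).comp (LinearMap.fst ℝ _ _) +
  -- Since `δ = α₀ + θ`, giving `α₀` height 1 forces `δ` to have height `ht θ + 1`.
  ((b.height θ : ℝ) + 1) • ((LinearMap.fst ℝ ℝ ℝ).comp (LinearMap.snd ℝ _ _))

theorem affineHeight_affRoot (b : P.Base) (θ : ι) (γ : ι) (k : ℤ) :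
    affineHeight b θ (affRoot P γ k) = b.height γ + (b.height θ + 1) * k := by
  obtain ⟨f, -, -, hf⟩ := b.exists_root_eq_sum_int γ
  have key : b.toWeightBasis.constr ℂ (fun _ => (1 : ℂ)) (P.root γ) = (b.height γ : ℂ) := by
    rw [Base.height_eq_sum hf, hf, map_sum, Int.cast_sum]
    refine Finset.sum_congr rfl fun j hj => ?_
    have : P.root j = b.toWeightBasis ⟨j, hj⟩ := by simp
    rw [this, map_zsmul, Basis.constr_basis]
    simp
  simp [affineHeight, key]

theorem affineHeight_simple (b : P.Base) (θ : ι) (i) :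
    affineHeight b θ (affineSimpleRoot b θ i) = 1 := by
  cases i with
  | none => rw [affineSimpleRoot_none, affineHeight_affRoot, height_neg]; push_cast; ring
  | some i =>
    rw [affineSimpleRoot_some, affineHeight_affRoot, Base.height_one_of_mem_support i.2]; simp

/-- The height counts simple summands, so only the empty sum has height 0. This makes the cone
pointed and the affine simple roots indecomposable. -/
theorem affineHeight_of_mem_cone (b : P.Base) (θ : ι) {x : AffineSpan P}
    (hx : x ∈ simpleCone b θ) : ∃ n : ℕ, affineHeight b θ x = n ∧ (n = 0 → x = 0) := by
  induction hx using AddSubmonoid.closure_induction with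
  | mem y hy =>
    obtain ⟨i, rfl⟩ := hy
    exact ⟨1, by simpa using affineHeight_simple b θ i, by simp⟩
  | zero => exact ⟨0, by simp⟩
  | add y z _ _ hy hz =>
    obtain ⟨m, h1, h2⟩ := hy
    obtain ⟨n, h3, h4⟩ := hz
    refine ⟨m + n, by simp [h1, h3], fun h => ?_⟩
    rw [h2 (by omega), h4 (by omega), add_zero]

theorem eq_zero_of_add_eq_zero (b : P.Base) (θ : ι) {x y : AffineSpan P}
    (hx : x ∈ simpleCone b θ) (hy : y ∈ simpleCone b θ) (h : x + y = 0) : x = 0 := by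
  obtain ⟨m, h1, h2⟩ := affineHeight_of_mem_cone b θ hx
  obtain ⟨n, h3, h4⟩ := affineHeight_of_mem_cone b θ hy
  have := congrArg (affineHeight b θ) h
  rw [map_add, h1, h3, map_zero] at this
  norm_cast at this
  exact h2 (by omega)

/-- Affine simple roots are indecomposable. -/
theorem eq_zero_or_eq_zero_of_add_eq_simple (b : P.Base) (θ : ι) {x y : AffineSpan P} {i}
    (hx : x ∈ simpleCone b θ) (hy : y ∈ simpleCone b θ) (h : x + y = affineSimpleRoot b θ i) :
    x = 0 ∨ y = 0 := by
  obtain ⟨m, h1, h2⟩ := affineHeight_of_mem_cone b θ hx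
  obtain ⟨n, h3, h4⟩ := affineHeight_of_mem_cone b θ hy
  have := congrArg (affineHeight b θ) h
  rw [map_add, h1, h3, affineHeight_simple] at this
  norm_cast at this
  rcases Nat.eq_zero_or_pos m with h | h
  · exact .inl (h2 h)
  · exact .inr (h4 (by omega))

theorem root_mem_closure_of_isPos (b : P.Base) {γ : ι} (h : b.IsPos γ) :
    P.root γ ∈ AddSubmonoid.closure (P.root '' b.support) := by
  refine (b.root_mem_or_neg_mem γ).resolve_right fun hn => ?_
  obtain ⟨x, hx, h1, h2⟩ := exists_mem_of_mem_closure b (support_mem_cone b γ) hn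
  have hx' : x = affRoot P (P.reflectionPerm γ γ) 0 := by
    refine Prod.ext (Subtype.ext ?_) (Prod.ext ?_ ?_) <;> simp [h1, h2]
  obtain ⟨n, h3, -⟩ := affineHeight_of_mem_cone b γ hx
  rw [hx', affineHeight_affRoot, height_neg] at h3
  rw [Base.isPos_iff] at h
  have : -b.height γ = n := by
    have h3' : ((-b.height γ : ℤ) : ℝ) = ((n : ℤ) : ℝ) := by simpa using h3
    exact_mod_cast h3'
  omega

theorem affRoot_zero_mem_cone (b : P.Base) (θ : ι) {γ : ι} (h : b.IsPos γ) :
    affRoot P γ 0 ∈ simpleCone b θ := by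
  obtain ⟨x, hx, h1, h2⟩ := exists_mem_of_mem_closure b (support_mem_cone b θ) (root_mem_closure_of_isPos b h)
  convert hx using 1
  refine Prod.ext (Subtype.ext ?_) (Prod.ext ?_ ?_) <;> simp [h1, h2]

variable {b : P.Base} {θ : ι} (hθ : IsHighestRoot b θ)

include hθ in
-- If `-θ` were positive, then `θ - (-θ)` and two copies of `-θ` would be elements of the pointed
-- cone with sum zero.
theorem IsHighestRoot.isPos : b.IsPos θ := by
  by_contra h
  have h' := (isPos_neg_iff b θ).2 h
  have h1 := sub_mem_cone_of_rootLE b θ (hθ (P.reflectionPerm θ θ)) 0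
  have h2 : affRoot P θ 0 = - affRoot P (P.reflectionPerm θ θ) 0 := by
    rw [neg_affRoot, affRoot_ext_iff]
    exact ⟨(neg_neg_index θ).symm, rfl⟩
  have h3 := affRoot_zero_mem_cone b θ h'
  have h4 := eq_zero_of_add_eq_zero b θ (add_mem h1 h3) h3 (by rw [h2]; abel)
  have h5 := eq_zero_of_add_eq_zero b θ h3 h1 (by rw [add_comm]; exact h4)
  exact affRoot_ne_zero _ _ h5

include hθ in
theorem delta_mem_cone : delta P ∈ simpleCone b θ := by
  rw [delta_eq b θ]
  exact add_mem (simple_mem_cone b θ none) (affRoot_zero_mem_cone b θ hθ.isPos)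

include hθ in
-- For `k ≥ 1`, `γ + kδ = (θ - (-γ)) + α₀ + (k - 1)δ`, and the first term is in the cone because `θ`
-- dominates `-γ`.
theorem pos_mem_cone {x : AffineSpan P} (hx : x ∈ positiveAffineRoots b) :
    x ∈ simpleCone b θ := by
  obtain ⟨γ, k, rfl⟩ := pos_subset b hx
  rw [affRoot_mem_pos_iff] at hx
  rcases hx with hx | ⟨rfl, hx⟩
  · have h1 := sub_mem_cone_of_rootLE b θ (hθ (P.reflectionPerm γ γ)) 0
    obtain ⟨n, rfl⟩ := Int.eq_ofNat_of_zero_le (sub_nonneg.2 hx) |>.imp fun n h =>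
      (sub_eq_iff_eq_add.1 h)
    have : affRoot P γ (n + 1) = (affRoot P θ 0 - affRoot P (P.reflectionPerm γ γ) 0) +
        affineSimpleRoot b θ none + n • delta P := by
      rw [affineSimpleRoot_none]
      refine Prod.ext (Subtype.ext ?_) (Prod.ext ?_ ?_) <;> simp [delta, add_comm]
    rw [this]
    exact add_mem (add_mem h1 (simple_mem_cone b θ none)) (nsmul_mem (delta_mem_cone hθ) n)
  · exact affRoot_zero_mem_cone b θ hx

include hθ in
theorem pos_of_mem_cone {x : AffineSpan P} (hx : x ∈ affineRoots P) (h : x ∈ simpleCone b θ) :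
    x ∈ positiveAffineRoots b := by
  refine (pos_or_neg_pos b hx).resolve_right fun h' => ?_
  have := eq_zero_of_add_eq_zero b θ h (pos_mem_cone hθ h') (add_neg_cancel x)
  obtain ⟨γ, k, rfl⟩ := hx
  exact affRoot_ne_zero _ _ this

include hθ in
theorem pos_add {x y : AffineSpan P} (hx : x ∈ positiveAffineRoots b)
    (hy : y ∈ positiveAffineRoots b) (h : x + y ∈ affineRoots P) :
    x + y ∈ positiveAffineRoots b :=
  pos_of_mem_cone hθ h (add_mem (pos_mem_cone hθ hx) (pos_mem_cone hθ hy))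

include hθ in
theorem pos_add_ne_simple {x y : AffineSpan P} (hx : x ∈ positiveAffineRoots b)
    (hy : y ∈ positiveAffineRoots b) (i) : x + y ≠ affineSimpleRoot b θ i := by
  intro h
  obtain ⟨γ, k, rfl⟩ := pos_subset b hx
  obtain ⟨γ', k', rfl⟩ := pos_subset b hy
  rcases eq_zero_or_eq_zero_of_add_eq_simple b θ (pos_mem_cone hθ hx) (pos_mem_cone hθ hy) h
    with h | h <;> exact affRoot_ne_zero _ _ h

end Height

end AffineRoots

end AbelianIdealNormaliser

namespace AbelianIdealNormaliser

open RootPairing Module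

section AffineReflections

variable {ι M N : Type*} [Fintype ι] [AddCommGroup M] [Module ℂ M] [AddCommGroup N] [Module ℂ N]
  {P : RootPairing ι ℂ M N} [P.IsCrystallographic]

/-! ### Affine reflections -/

theorem two_mul_rootFormIn (γ β : ι) :
    2 * P.RootFormIn ℝ (P.rootSpanMem ℝ γ) (P.rootSpanMem ℝ β) =
      P.pairingIn ℤ γ β * P.RootFormIn ℝ (P.rootSpanMem ℝ β) (P.rootSpanMem ℝ β) := by
  have h := (P.posRootForm ℝ).toInvariantForm.two_mul_apply_root_root γ β
  rw [← P.algebraMap_pairingIn ℤ] at h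
  apply (algebraMap ℝ ℂ).injective
  rw [map_mul, map_mul, algebraMap_rootFormIn, algebraMap_rootFormIn]
  simpa [posRootForm] using h

theorem affineForm_affRoot (γ β : ι) (k m : ℤ) :
    affineForm P (affRoot P γ k) (affRoot P β m) =
      P.RootFormIn ℝ (P.rootSpanMem ℝ γ) (P.rootSpanMem ℝ β) := by
  simp [affineForm]

theorem two_mul_affineForm (γ β : ι) (k m : ℤ) :
    2 * affineForm P (affRoot P γ k) (affRoot P β m) =
      P.pairingIn ℤ γ β * affineForm P (affRoot P β m) (affRoot P β m) := by
  simp_rw [affineForm_affRoot, two_mul_rootFormIn]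

theorem affineForm_self_pos (γ : ι) (k : ℤ) :
    0 < affineForm P (affRoot P γ k) (affRoot P γ k) := by
  have h := (P.posRootForm ℝ).zero_lt_posForm_apply_root γ
    (Submodule.subset_span (Set.mem_range_self γ))
  rw [posRootForm_eq] at h
  rwa [affineForm_affRoot]

theorem affineForm_comm (x y : AffineSpan P) : affineForm P x y = affineForm P y x := by
  have h := (P.rootFormIn_isSymm ℝ).eq x.1 y.1
  simp only [affineForm, LinearMap.mk₂_apply]
  rw [← h]
  simp
  ring

theorem affineForm_delta (x : AffineSpan P) : affineForm P (delta P) x = x.2.2 := by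
  simp [affineForm, delta]

theorem affineForm_pos_iff {γ β : ι} (k m : ℤ) :
    0 < affineForm P (affRoot P γ k) (affRoot P β m) ↔ 0 < P.pairingIn ℤ γ β := by
  have h := two_mul_affineForm (P := P) γ β k m
  have h' := affineForm_self_pos (P := P) β m
  rw [← Int.cast_pos (R := ℝ)]
  constructor <;> intro h'' <;> nlinarith

theorem affineForm_eq_zero_iff {γ β : ι} (k m : ℤ) :
    affineForm P (affRoot P γ k) (affRoot P β m) = 0 ↔ P.pairingIn ℤ γ β = 0 := by
  have h := two_mul_affineForm (P := P) γ β k m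
  have h' := affineForm_self_pos (P := P) β m
  rw [← Int.cast_eq_zero (α := ℝ)]
  refine ⟨fun h0 => ?_, fun h0 => ?_⟩
  · rw [h0, mul_zero, eq_comm] at h
    exact (mul_eq_zero.1 h).resolve_right h'.ne'
  · rw [h0, zero_mul] at h
    linarith

theorem affineForm_neg_iff {γ β : ι} (k m : ℤ) :
    affineForm P (affRoot P γ k) (affRoot P β m) < 0 ↔ P.pairingIn ℤ γ β < 0 := by
  have h1 := affineForm_pos_iff (P := P) (γ := γ) (β := β) k m
  have h2 := affineForm_eq_zero_iff (P := P) (γ := γ) (β := β) k m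
  rw [← not_le, ← not_le, le_iff_lt_or_eq, le_iff_lt_or_eq, h1, eq_comm, h2, eq_comm]

theorem sub_smul_affineCoroot (γ β : ι) (k m : ℤ) :
    affRoot P γ k - affineForm P (affRoot P γ k) (affRoot P β m) • affineCoroot P (affRoot P β m) =
      affRoot P (P.reflectionPerm β γ) (k - P.pairingIn ℤ γ β * m) := by
  have h := two_mul_affineForm (P := P) γ β k m
  have h' := affineForm_self_pos (P := P) β m
  have : affineForm P (affRoot P γ k) (affRoot P β m) *
      (2 / affineForm P (affRoot P β m) (affRoot P β m)) = P.pairingIn ℤ γ β := by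
    field_simp
    linarith
  rw [affineCoroot, smul_smul, this]
  refine Prod.ext (Subtype.ext ?_) (Prod.ext ?_ ?_)
  · have h3 : P.root (P.reflectionPerm β γ) = P.root γ - P.pairingIn ℤ γ β • P.root β := by
      rw [root_reflectionPerm, reflection_apply_root' ℤ]
    simp [h3, Int.cast_smul_eq_zsmul]
  · simp
  · simp

theorem root_reflectionPerm_eq (γ β : ι) :
    P.root (P.reflectionPerm β γ) = P.root γ + (-P.pairingIn ℤ γ β) • P.root β := by
  rw [root_reflectionPerm, reflection_apply_root' ℤ, neg_smul, sub_eq_add_neg]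

theorem affineReflection_mem_affineRoots {x a : AffineSpan P} (hx : x ∈ affineRoots P)
    (ha : a ∈ affineRoots P) (h) : affineReflection P a h x ∈ affineRoots P := by
  obtain ⟨γ, k, rfl⟩ := hx
  obtain ⟨β, m, rfl⟩ := ha
  rw [affineReflection_apply, sub_smul_affineCoroot]
  exact affRoot_mem _ _

theorem affineReflection_self {a : AffineSpan P} (h) : affineReflection P a h a = -a := by
  rw [affineReflection_apply, affineCoroot, smul_smul, mul_div_cancel₀ _ h, two_smul]
  abel

theorem affineReflection_involutive {a : AffineSpan P} (h) (x : AffineSpan P) :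
    affineReflection P a h (affineReflection P a h x) = x := by
  have h2 : affineForm P a a * (2 / affineForm P a a) = 2 := mul_div_cancel₀ _ h
  simp only [affineReflection_apply, affineCoroot, map_sub, map_smul, smul_smul, h2]
  module

theorem affineForm_affineReflection {a : AffineSpan P} (h) (x y : AffineSpan P) :
    affineForm P (affineReflection P a h x) (affineReflection P a h y) = affineForm P x y := by
  have h2 : affineForm P a a * (2 / affineForm P a a) = 2 := mul_div_cancel₀ _ h
  simp only [affineReflection_apply, affineCoroot, map_sub, map_smul, LinearMap.sub_apply,
    LinearMap.smul_apply, smul_eq_mul, affineForm_comm a y]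
  linear_combination (affineForm P x a * affineForm P y a * (2 / affineForm P a a)) * h2

theorem affineReflection_delta {a : AffineSpan P} (ha : a ∈ affineRoots P) (h) :
    affineReflection P a h (delta P) = delta P := by
  obtain ⟨β, m, rfl⟩ := ha
  rw [affineReflection_apply, affineForm_delta, affRoot_snd_snd, zero_smul, sub_zero]

theorem pairingIn_neg_index_left (γ β : ι) :
    P.pairingIn ℤ (P.reflectionPerm γ γ) β = -P.pairingIn ℤ γ β := by
  simp

theorem pairingIn_neg_index_right (γ β : ι) :
    P.pairingIn ℤ γ (P.reflectionPerm β β) = -P.pairingIn ℤ γ β := by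
  simp

/-! ### The highest root -/

section HighestRoot

variable [P.IsRootSystem] {b : P.Base} {θ : ι} (hθ : IsHighestRoot b θ)

include hθ in
theorem height_le_highest (γ : ι) : b.height γ ≤ b.height θ ∧
    (b.height γ = b.height θ → γ = θ) := by
  obtain ⟨n, h1, h2⟩ := affineHeight_of_mem_cone b θ (sub_mem_cone_of_rootLE b θ (hθ γ) 0)
  rw [map_sub, affineHeight_affRoot, affineHeight_affRoot] at h1
  have h3 : b.height θ - b.height γ = (n : ℤ) := by
    have h1' : ((b.height θ - b.height γ : ℤ) : ℝ) = ((n : ℤ) : ℝ) := by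
      rw [← Int.cast_natCast] at h1
      push_cast at h1 ⊢
      linarith
    exact_mod_cast h1'
  refine ⟨by omega, fun h => ?_⟩
  have := sub_eq_zero.1 (h2 (by omega))
  rw [affRoot_ext_iff] at this
  exact this.1.symm

include hθ in
-- Otherwise `⟨θ, β^∨⟩ < 0` too, and `s_β(θ)` would be higher than `θ`.
theorem pairingIn_highest_nonneg {β : ι} (hβ : b.IsPos β) : 0 ≤ P.pairingIn ℤ β θ := by
  by_contra h
  rw [not_le, ← affineForm_neg_iff 0 0, affineForm_comm, affineForm_neg_iff] at h
  have h1 := b.height_add_zsmul (root_reflectionPerm_eq (P := P) θ β)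
  have h2 := (height_le_highest hθ (P.reflectionPerm β θ)).1
  rw [Base.isPos_iff] at hβ
  rw [smul_eq_mul] at h1
  nlinarith

include hθ in
-- With `p = ⟨γ, θ^∨⟩`, the root `-s_θ(γ)` has height `p ht θ - ht γ`, which exceeds `ht θ` once `p
-- ≥ 2` and `ht γ < ht θ`.
theorem pairingIn_highest_le_one {γ : ι} (hγ : γ ≠ θ) : P.pairingIn ℤ γ θ ≤ 1 := by
  have h0 := hθ.isPos
  rw [Base.isPos_iff] at h0
  have h1 := b.height_add_zsmul (root_reflectionPerm_eq (P := P) γ θ)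
  have h2 := (height_le_highest hθ (P.reflectionPerm (P.reflectionPerm θ γ) (P.reflectionPerm θ γ))).1
  rw [height_neg, h1, smul_eq_mul] at h2
  have h3 := height_le_highest hθ γ
  have h4 : b.height γ < b.height θ := lt_of_le_of_ne h3.1 fun h => hγ (h3.2 h)
  by_contra h
  nlinarith

include hθ in
theorem neg_one_le_pairingIn_highest {γ : ι} (hγ : γ ≠ P.reflectionPerm θ θ) :
    -1 ≤ P.pairingIn ℤ γ θ := by
  have := pairingIn_highest_le_one hθ (γ := P.reflectionPerm γ γ) fun h => hγ (by
    rw [← h, neg_neg_index])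
  rw [pairingIn_neg_index_left] at this
  omega

end HighestRoot

/-! ### The affine Weyl group -/

section Weyl

variable {b : P.Base} {θ : ι}

theorem simpleReflection_self (i) : affineSimpleReflection b θ i (affineSimpleRoot b θ i) =
    -affineSimpleRoot b θ i := affineReflection_self _

theorem simpleReflection_mul_self (i) :
    affineSimpleReflection b θ i * affineSimpleReflection b θ i = 1 :=
  LinearEquiv.ext fun x => affineReflection_involutive _ x

theorem simpleReflection_inv (i) :
    (affineSimpleReflection b θ i)⁻¹ = affineSimpleReflection b θ i :=
  inv_eq_of_mul_eq_one_left (simpleReflection_mul_self i)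

theorem simpleReflection_mem (i) : affineSimpleReflection b θ i ∈ affineWeylGroup b θ :=
  Subgroup.subset_closure ⟨i, rfl⟩

theorem exists_word {w : AffineSpan P ≃ₗ[ℝ] AffineSpan P} (hw : w ∈ affineWeylGroup b θ) :
    ∃ l : List (Option b.support), w = (l.map (affineSimpleReflection b θ)).prod := by
  induction hw using Subgroup.closure_induction with
  | mem x hx => obtain ⟨i, rfl⟩ := hx; exact ⟨[i], by simp⟩
  | one => exact ⟨[], rfl⟩
  | mul x y _ _ hx hy =>
    obtain ⟨l, rfl⟩ := hx
    obtain ⟨l', rfl⟩ := hy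
    exact ⟨l ++ l', by simp⟩
  | inv x _ hx =>
    obtain ⟨l, rfl⟩ := hx
    refine ⟨l.reverse, ?_⟩
    rw [List.prod_inv_reverse, List.map_map, List.map_reverse]
    congr 2

theorem word_mem (l : List (Option b.support)) :
    (l.map (affineSimpleReflection b θ)).prod ∈ affineWeylGroup b θ :=
  Subgroup.list_prod_mem _ fun x hx => by
    obtain ⟨i, -, rfl⟩ := List.mem_map.1 hx
    exact simpleReflection_mem i

variable {w : AffineSpan P ≃ₗ[ℝ] AffineSpan P} (hw : w ∈ affineWeylGroup b θ)

include hw in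
theorem weyl_mem_affineRoots {x : AffineSpan P} (hx : x ∈ affineRoots P) :
    w x ∈ affineRoots P := by
  obtain ⟨l, rfl⟩ := exists_word hw
  clear hw
  induction l with
  | nil => exact hx
  | cons i l ih =>
    rw [List.map_cons, List.prod_cons, LinearEquiv.mul_apply]
    exact affineReflection_mem_affineRoots ih (simple_mem_affineRoots b θ i) _

include hw in
theorem weyl_form (x y : AffineSpan P) : affineForm P (w x) (w y) = affineForm P x y := by
  obtain ⟨l, rfl⟩ := exists_word hw
  clear hw
  induction l with
  | nil => rfl
  | cons i l ih =>
    rw [List.map_cons, List.prod_cons, LinearEquiv.mul_apply, LinearEquiv.mul_apply, ← ih]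
    exact affineForm_affineReflection _ _ _

include hw in
theorem weyl_delta : w (delta P) = delta P := by
  obtain ⟨l, rfl⟩ := exists_word hw
  clear hw
  induction l with
  | nil => rfl
  | cons i l ih =>
    rw [List.map_cons, List.prod_cons, LinearEquiv.mul_apply, ih]
    exact affineReflection_delta (simple_mem_affineRoots b θ i) _

@[simp] theorem weyl_apply_inv (w : AffineSpan P ≃ₗ[ℝ] AffineSpan P) (x) : w (w⁻¹ x) = x :=
  w.apply_symm_apply x

@[simp] theorem weyl_inv_apply (w : AffineSpan P ≃ₗ[ℝ] AffineSpan P) (x) : w⁻¹ (w x) = x :=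
  w.symm_apply_apply x

/-- Conjugating a simple reflection. -/
theorem weyl_mul_simpleReflection {w : AffineSpan P ≃ₗ[ℝ] AffineSpan P}
    (hw : w ∈ affineWeylGroup b θ) {i j}
    (h : w (affineSimpleRoot b θ i) = affineSimpleRoot b θ j) :
    w * affineSimpleReflection b θ i = affineSimpleReflection b θ j * w := by
  ext1 x
  rw [LinearEquiv.mul_apply, LinearEquiv.mul_apply, affineSimpleReflection, affineSimpleReflection,
    affineReflection_apply, affineReflection_apply, affineCoroot, affineCoroot, map_sub,
    map_smul, map_smul, h, ← h, weyl_form hw, weyl_form hw]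

variable [P.IsRootSystem] [P.IsReduced] (hθ : IsHighestRoot b θ)

include hθ in
/-- The simple reflection `sᵢ` permutes the positive affine roots different from `αᵢ`. -/
theorem simpleReflection_pos {x : AffineSpan P} (hx : x ∈ positiveAffineRoots b) {i}
    (hne : x ≠ affineSimpleRoot b θ i) :
    affineSimpleReflection b θ i x ∈ positiveAffineRoots b := by
  obtain ⟨γ, k, rfl⟩ := pos_subset b hx
  rw [affRoot_mem_pos_iff] at hx
  rw [affineSimpleReflection, affineReflection_apply]
  cases i with
  | some i =>
    rw [affineSimpleRoot_some] at hne ⊢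
    rw [sub_smul_affineCoroot, affRoot_mem_pos_iff, mul_zero, sub_zero]
    refine hx.imp_right fun ⟨h, h'⟩ => ⟨h, h'.reflectionPerm i.2 fun hi => hne ?_⟩
    rw [hi, h]
  | none =>
    rw [affineSimpleRoot_none] at hne ⊢
    rw [sub_smul_affineCoroot, affRoot_mem_pos_iff, mul_one, pairingIn_neg_index_right]
    have h1 := b.height_add_zsmul (root_reflectionPerm_eq (P := P) γ (P.reflectionPerm θ θ))
    rw [pairingIn_neg_index_right, height_neg, smul_eq_mul] at h1
    rw [Base.isPos_iff] at hx ⊢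
    have h0 := hθ.isPos
    have hd := fun h => pairingIn_highest_nonneg hθ (β := γ) h
    rw [Base.isPos_iff] at h0 hd
    have hle := (height_le_highest hθ (P.reflectionPerm γ γ))
    rw [height_neg] at hle
    set p := P.pairingIn ℤ γ θ with hp
    -- `s₀` raises the level by `p`, and `p ≥ -1` unless `γ = -θ`. The height decides only when the
    -- new level is 0; for `p = -1` the new height is `ht γ + ht θ > 0`.
    by_cases hγ : γ = P.reflectionPerm θ θ
    · have hp2 : p = -2 := by rw [hp, hγ, pairingIn_neg_index_left]; simp
      have hk : k ≠ 1 := fun h => hne (by rw [h, hγ])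
      have hh : b.height γ = -b.height θ := by rw [hγ, height_neg]
      rw [hp2, hh] at h1
      omega
    · have hp1 := neg_one_le_pairingIn_highest hθ hγ
      rw [← hp] at hp1
      have hlt : -b.height γ < b.height θ := lt_of_le_of_ne hle.1 fun h => hγ (by
        rw [← hle.2 h, neg_neg_index])
      rcases hx with hx | ⟨rfl, hx⟩
      · by_cases h2 : p = -1
        · rw [h2] at h1 ⊢
          omega
        · omega
      · have := hd hx
        by_cases h2 : p = 0
        · rw [h2] at h1 ⊢
          omega
        · omega

include hθ in
/-- The exchange property. -/
theorem exists_word_mul_simpleReflection (l : List (Option b.support)) (i)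
    (h : -((l.map (affineSimpleReflection b θ)).prod (affineSimpleRoot b θ i)) ∈
      positiveAffineRoots b) :
    ∃ l' : List (Option b.support), l'.length < l.length ∧
      (l.map (affineSimpleReflection b θ)).prod * affineSimpleReflection b θ i =
        (l'.map (affineSimpleReflection b θ)).prod := by
  induction l with
  | nil => exact absurd h (not_neg_pos b (simple_pos b θ i))
  | cons j l ih =>
    set v := (l.map (affineSimpleReflection b θ)).prod with hv
    by_cases hn : -(v (affineSimpleRoot b θ i)) ∈ positiveAffineRoots b
    · obtain ⟨l', h1, h2⟩ := ih hn
      exact ⟨j :: l', by simpa using h1, by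
        rw [List.map_cons, List.prod_cons, mul_assoc, ← hv, h2, List.map_cons, List.prod_cons]⟩
    · have hp := (pos_or_neg_pos b (weyl_mem_affineRoots (word_mem (θ := θ) l)
        (simple_mem_affineRoots b θ i))).resolve_right hn
      -- The root `v(α_i)` is positive and `s_j` makes it negative, so it is `α_j`. Hence `s_j v s_i
      -- = v`, and the letter `j` can be deleted.
      have heq : v (affineSimpleRoot b θ i) = affineSimpleRoot b θ j := by
        by_contra hne
        refine not_neg_pos b (simpleReflection_pos hθ hp hne) ?_
        simpa [List.map_cons, List.prod_cons, LinearEquiv.mul_apply] using h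
      refine ⟨l, by simp, ?_⟩
      rw [List.map_cons, List.prod_cons, mul_assoc, ← hv,
        weyl_mul_simpleReflection (word_mem (θ := θ) l) heq, ← mul_assoc,
        simpleReflection_mul_self, one_mul]

include hθ in
/-- An element of the affine Weyl group which inverts no simple root is trivial. -/
theorem eq_one_of_forall_simple_pos {w : AffineSpan P ≃ₗ[ℝ] AffineSpan P}
    (hw : w ∈ affineWeylGroup b θ)
    (h : ∀ i, w (affineSimpleRoot b θ i) ∈ positiveAffineRoots b) : w = 1 := by
  obtain ⟨l, rfl⟩ := exists_word hw
  clear hw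
  induction hn : l.length using Nat.strong_induction_on generalizing l with
  | _ n ih =>
    rcases List.eq_nil_or_concat' l with rfl | ⟨l', i, rfl⟩
    · rfl
    · have hprod : ((l' ++ [i]).map (affineSimpleReflection b θ)).prod =
          (l'.map (affineSimpleReflection b θ)).prod * affineSimpleReflection b θ i := by simp
      -- With `i` the last letter, the rest of the word sends `α_i` to a negative root, so the
      -- exchange property yields a shorter word for the same element.
      have hi := h i
      rw [hprod, LinearEquiv.mul_apply, simpleReflection_self, map_neg] at hi
      obtain ⟨l'', h1, h2⟩ := exists_word_mul_simpleReflection hθ l' i hi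
      rw [hprod, h2] at h ⊢
      refine ih l''.length ?_ l'' h rfl
      rw [← hn, List.length_append, List.length_singleton]
      omega

end Weyl

end AffineReflections

end AbelianIdealNormaliser

namespace AbelianIdealNormaliser

open RootPairing Module

section Minuscule

variable {ι M N : Type*} [Fintype ι] [AddCommGroup M] [Module ℂ M] [AddCommGroup N] [Module ℂ N]
  {P : RootPairing ι ℂ M N} [P.IsCrystallographic] {b : P.Base} {θ : ι}

/-! ### Elements of the affine Weyl group and levels -/

theorem simpleReflection_some_affRoot (j : b.support) (γ : ι) (k : ℤ) :
    affineSimpleReflection b θ (some j) (affRoot P γ k) = affRoot P (P.reflectionPerm j γ) k := by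
  simp_rw [affineSimpleReflection, affineReflection_apply, affineSimpleRoot_some]
  rw [sub_smul_affineCoroot, mul_zero, sub_zero]

theorem simpleReflection_none_affRoot (γ : ι) (k : ℤ) :
    affineSimpleReflection b θ none (affRoot P γ k) =
      affRoot P (P.reflectionPerm (P.reflectionPerm θ θ) γ) (k + P.pairingIn ℤ γ θ) := by
  simp_rw [affineSimpleReflection, affineReflection_apply, affineSimpleRoot_none]
  rw [sub_smul_affineCoroot, mul_one, pairingIn_neg_index_right, sub_neg_eq_add]

theorem simpleReflection_of_form_eq_zero {i} {x : AffineSpan P}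
    (h : affineForm P x (affineSimpleRoot b θ i) = 0) : affineSimpleReflection b θ i x = x := by
  rw [affineSimpleReflection, affineReflection_apply, h, zero_smul, sub_zero]

theorem nonneg_of_mem_cone {φ : AffineSpan P →ₗ[ℝ] ℝ}
    (h : ∀ i, 0 ≤ φ (affineSimpleRoot b θ i)) {x : AffineSpan P} (hx : x ∈ simpleCone b θ) :
    0 ≤ φ x := by
  induction hx using AddSubmonoid.closure_induction with
  | mem y hy => obtain ⟨i, rfl⟩ := hy; exact h i
  | zero => simp
  | add y z _ _ hy hz => rw [map_add]; exact add_nonneg hy hz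

/-- By additivity some simple summand has a positive value. The intended `φ` is the inner product
with `x` itself. -/
theorem exists_simple_of_mem_cone {φ : AffineSpan P →ₗ[ℝ] ℝ} {x : AffineSpan P}
    (hx : x ∈ simpleCone b θ) (h : 0 < φ x) :
    ∃ i, 0 < φ (affineSimpleRoot b θ i) ∧ x - affineSimpleRoot b θ i ∈ simpleCone b θ := by
  induction hx using AddSubmonoid.closure_induction with
  | mem y hy => obtain ⟨i, rfl⟩ := hy; exact ⟨i, h, by rw [sub_self]; exact zero_mem _⟩
  | zero => simp at h
  | add y z hy' hz' hy hz =>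
    rw [map_add] at h
    by_cases h1 : 0 < φ y
    · obtain ⟨i, h2, h3⟩ := hy h1
      exact ⟨i, h2, by rw [add_sub_right_comm]; exact add_mem h3 hz'⟩
    · obtain ⟨i, h2, h3⟩ := hz (by linarith)
      exact ⟨i, h2, by rw [add_sub_assoc]; exact add_mem hy' h3⟩

variable (P) in
/-- The coefficient of `δ`. -/
noncomputable def level : AffineSpan P →ₗ[ℝ] ℝ :=
  (LinearMap.fst ℝ ℝ ℝ).comp (LinearMap.snd ℝ _ _)

@[simp] theorem level_affRoot (γ : ι) (k : ℤ) : level P (affRoot P γ k) = k := affRoot_snd_fst γ k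

@[simp] theorem level_delta : level P (delta P) = 1 := rfl

variable [P.IsRootSystem] [P.IsReduced] (hθ : IsHighestRoot b θ)

include hθ in
/-- An element of the affine Weyl group whose inversions all have level zero belongs to the finite
Weyl group, that is, it preserves levels. -/
theorem level_weyl_of_inversions {v : AffineSpan P ≃ₗ[ℝ] AffineSpan P}
    (hv : v ∈ affineWeylGroup b θ)
    (h : ∀ γ k, affRoot P γ k ∈ positiveAffineRoots b →
      -(v (affRoot P γ k)) ∈ positiveAffineRoots b → k = 0) (γ : ι) (k : ℤ) :
    level P (v (affRoot P γ k)) = k := by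
  induction hn : {γ | b.IsPos γ ∧ -(v (affRoot P γ 0)) ∈ positiveAffineRoots b}.ncard using
    Nat.strong_induction_on generalizing v γ k with
  | _ n ih =>
    by_cases hall : ∀ i, v (affineSimpleRoot b θ i) ∈ positiveAffineRoots b
    · rw [eq_one_of_forall_simple_pos hθ hv hall]
      exact level_affRoot γ k
    push Not at hall
    obtain ⟨i, hi⟩ := hall
    replace hi := (pos_or_neg_pos b (weyl_mem_affineRoots hv (simple_mem_affineRoots b θ i))
      ).resolve_left hi
    cases i with
    | none =>
      have hp := simple_pos b θ none
      rw [affineSimpleRoot_none] at hi hp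
      exact absurd (h _ _ hp hi) one_ne_zero
    | some j =>
      rw [affineSimpleRoot_some] at hi
      have hne : ∀ γ k, affRoot P γ k ∈ positiveAffineRoots b →
          -((v * affineSimpleReflection b θ (some j)) (affRoot P γ k)) ∈ positiveAffineRoots b →
          affRoot P (P.reflectionPerm j γ) k ∈ positiveAffineRoots b := by
        intro γ k h1 h2
        rw [← simpleReflection_some_affRoot (θ := θ)]
        refine simpleReflection_pos hθ h1 fun h3 => not_neg_pos b hi ?_
        rwa [LinearEquiv.mul_apply, h3, simpleReflection_self, map_neg, affineSimpleRoot_some]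
          at h2
      -- `s_j` maps the level-zero inversions of `v s_j` injectively into those of `v` other than
      -- `α_j`, so the induction hypothesis applies to `v s_j`.
      have key := ih _ ?_ (mul_mem hv (simpleReflection_mem (some j))) ?_
        (P.reflectionPerm j γ) k rfl
      · rwa [LinearEquiv.mul_apply, simpleReflection_some_affRoot, P.reflectionPerm_self] at key
      · rw [← hn]
        have hj : (j : ι) ∈ {γ | b.IsPos γ ∧ -(v (affRoot P γ 0)) ∈ positiveAffineRoots b} :=
          ⟨Base.isPos_of_mem_support j.2, hi⟩
        refine lt_of_le_of_lt (Set.ncard_le_ncard_of_injOn (t := _ \ {(j : ι)})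
          (P.reflectionPerm j) ?_ (P.reflectionPerm j).injective.injOn (Set.toFinite _))
          (Set.ncard_sdiff_singleton_lt_of_mem hj (Set.toFinite _))
        rintro γ ⟨h1, h2⟩
        have h3 := hne γ 0 ((affRoot_mem_pos_iff b).2 (.inr ⟨rfl, h1⟩)) h2
        rw [affRoot_mem_pos_iff] at h3
        refine ⟨⟨(h3.resolve_left (by norm_num)).2, ?_⟩, fun h4 => ?_⟩
        · rwa [LinearEquiv.mul_apply, simpleReflection_some_affRoot] at h2
        · rw [Set.mem_singleton_iff] at h4
          have h5 : γ = P.reflectionPerm j j := by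
            rw [← congrArg (P.reflectionPerm j) h4, P.reflectionPerm_self]
          rw [h5, isPos_neg_iff] at h1
          exact h1 (Base.isPos_of_mem_support j.2)
      · intro γ k h1 h2
        have h3 := hne γ k h1 h2
        rw [LinearEquiv.mul_apply, simpleReflection_some_affRoot] at h2
        exact h _ _ h3 h2

/-! ### Minuscule elements with a given simple rootlet -/

variable (b θ) in
/-- `w` is a minuscule element with set of positive roots `I` and rootlet `μ`. -/
structure IsMinusculeOver (μ : ι) (I : Set ι) (w : AffineSpan P ≃ₗ[ℝ] AffineSpan P) : Prop where
  isPos : ∀ γ ∈ I, b.IsPos γ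
  minuscule : IsMinusculeWith b θ I w
  rootlet : w (affineSimpleRoot b θ none) + delta P = ofRoot P μ

theorem delta_sub_ofRoot (γ : ι) : delta P - ofRoot P γ = affRoot P (P.reflectionPerm γ γ) 1 := by
  refine Prod.ext (Subtype.ext ?_) (Prod.ext ?_ ?_) <;> simp [ofRoot, delta]

theorem simpleReflection_pos_iff (hθ : IsHighestRoot b θ) {x : AffineSpan P}
    (hx : x ∈ affineRoots P) {i}
    (h1 : x ≠ affineSimpleRoot b θ i) (h2 : -x ≠ affineSimpleRoot b θ i) :
    affineSimpleReflection b θ i x ∈ positiveAffineRoots b ↔ x ∈ positiveAffineRoots b := by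
  refine ⟨fun h => ?_, fun h => simpleReflection_pos hθ h h1⟩
  refine (pos_or_neg_pos b hx).resolve_right fun h' => ?_
  have := simpleReflection_pos hθ h' h2
  rw [map_neg] at this
  exact not_neg_pos b h this

namespace IsMinusculeOver

variable {μ : ι} {I : Set ι} {w : AffineSpan P ≃ₗ[ℝ] AffineSpan P}
  (h : IsMinusculeOver b θ μ I w)

include h

theorem mem_weyl : w ∈ affineWeylGroup b θ := h.minuscule.1

theorem exists_of_neg {x : AffineSpan P} (hx : x ∈ positiveAffineRoots b)
    (hx' : -(w x) ∈ positiveAffineRoots b) : ∃ γ ∈ I, x = affRoot P (P.reflectionPerm γ γ) 1 := by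
  have : x ∈ inversionSet b w := ⟨hx, hx'⟩
  rw [h.minuscule.2] at this
  obtain ⟨γ, hγ, rfl⟩ := this
  exact ⟨γ, hγ, delta_sub_ofRoot γ⟩

theorem mem_iff (γ : ι) :
    γ ∈ I ↔ -(w (affRoot P (P.reflectionPerm γ γ) 1)) ∈ positiveAffineRoots b := by
  constructor
  · intro hγ
    have : delta P - ofRoot P γ ∈ inversionSet b w := by
      rw [h.minuscule.2]
      exact ⟨γ, hγ, rfl⟩
    rw [delta_sub_ofRoot] at this
    exact this.2
  · intro hγ
    obtain ⟨γ', h1, h2⟩ := h.exists_of_neg ((affRoot_mem_pos_iff b).2 (.inl le_rfl)) hγ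
    rw [affRoot_ext_iff] at h2
    have : γ = γ' := by rw [← neg_neg_index (P := P) γ, h2.1, neg_neg_index]
    rwa [this]

theorem pos_of_level_ne_one {γ : ι} {k : ℤ} (hp : affRoot P γ k ∈ positiveAffineRoots b)
    (hk : k ≠ 1) : w (affRoot P γ k) ∈ positiveAffineRoots b := by
  refine (pos_or_neg_pos b (weyl_mem_affineRoots h.mem_weyl (affRoot_mem γ k))).resolve_right
    fun hn => hk ?_
  obtain ⟨γ', -, h2⟩ := h.exists_of_neg hp hn
  exact (affRoot_ext_iff.1 h2).2

theorem pos_of_isPos {γ : ι} (hγ : b.IsPos γ) :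
    w (affRoot P γ 0) ∈ positiveAffineRoots b :=
  h.pos_of_level_ne_one ((affRoot_mem_pos_iff b).2 (.inr ⟨rfl, hγ⟩)) zero_ne_one

theorem apply_simple_none : w (affineSimpleRoot b θ none) = affRoot P μ (-1) := by
  rw [eq_sub_of_add_eq h.rootlet]
  simp [affRoot, sub_eq_add_neg]

/-- Add `δ`, which `w` fixes, to `α₀ = δ - θ`. This transports orthogonality to `μ` into
orthogonality to `θ`. -/
theorem inv_rootlet : w⁻¹ (affRoot P μ 0) = affRoot P (P.reflectionPerm θ θ) 2 := by
  apply w.injective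
  rw [weyl_apply_inv]
  have h1 : affRoot P (P.reflectionPerm θ θ) 2 = affineSimpleRoot b θ none + delta P := by
    rw [affineSimpleRoot_none]
    simp only [affRoot]
    module
  rw [h1, map_add, weyl_delta h.mem_weyl, h.rootlet, ofRoot_eq]

theorem theta_mem : θ ∈ I := by
  rw [h.mem_iff, ← affineSimpleRoot_none b, h.apply_simple_none, neg_affRoot, affRoot_mem_pos_iff]
  exact .inl (by norm_num)

/-- The inverse image of an affine simple root, when negative, is `γ - δ` with `γ ∈ I`. -/
theorem inv_simple_neg {i} {γ : ι} {k : ℤ} (hi : w⁻¹ (affineSimpleRoot b θ i) = affRoot P γ k)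
    (hn : affRoot P γ k ∉ positiveAffineRoots b) : γ ∈ I ∧ k = -1 := by
  rw [← neg_pos_iff b (affRoot_mem γ k)] at hn
  have h1 : -(w (-affRoot P γ k)) ∈ positiveAffineRoots b := by
    rw [← hi, map_neg, weyl_apply_inv, neg_neg]
    exact simple_pos b θ i
  obtain ⟨γ', h2, h3⟩ := h.exists_of_neg hn h1
  rw [neg_affRoot, affRoot_ext_iff] at h3
  have : γ = γ' := by rw [← neg_neg_index (P := P) γ, h3.1, neg_neg_index]
  exact ⟨this ▸ h2, by omega⟩

theorem exists_inv_simple (i) : ∃ γ k, w⁻¹ (affineSimpleRoot b θ i) = affRoot P γ k :=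
  weyl_mem_affineRoots (inv_mem h.mem_weyl) (simple_mem_affineRoots b θ i)

theorem form_inv_simple {i} {γ : ι} {k : ℤ} (hi : w⁻¹ (affineSimpleRoot b θ i) = affRoot P γ k) :
    affineForm P (affineSimpleRoot b θ i) (affRoot P μ 0) =
      -affineForm P (affRoot P γ k) (affRoot P θ (-2)) := by
  rw [← weyl_form (inv_mem h.mem_weyl), hi, h.inv_rootlet, ← map_neg, neg_affRoot, neg_neg]

theorem form_simple_eq_zero_iff {i} {γ : ι} {k : ℤ}
    (hi : w⁻¹ (affineSimpleRoot b θ i) = affRoot P γ k) :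
    affineForm P (affineSimpleRoot b θ i) (affRoot P μ 0) = 0 ↔ P.pairingIn ℤ γ θ = 0 := by
  rw [h.form_inv_simple hi, neg_eq_zero, affineForm_eq_zero_iff]

omit h in
theorem form_simple_nonpos (hθ : IsHighestRoot b θ) (hμ : μ ∈ b.support) {i}
    (hi : affineSimpleRoot b θ i ≠ affRoot P μ 0) :
    affineForm P (affineSimpleRoot b θ i) (affRoot P μ 0) ≤ 0 := by
  cases i with
  | none =>
    rw [affineSimpleRoot_none, affineForm_comm, ← not_lt, affineForm_pos_iff,
      pairingIn_neg_index_right]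
    have := pairingIn_highest_nonneg hθ (Base.isPos_of_mem_support hμ)
    omega
  | some j =>
    rw [affineSimpleRoot_some] at hi ⊢
    rw [← not_lt, affineForm_pos_iff, not_lt]
    exact b.pairingIn_le_zero_of_ne (fun hj => hi (by rw [hj])) j.2 hμ

theorem pairingIn_nonneg (hθ : IsHighestRoot b θ) (hμ : μ ∈ b.support) {i}
    (hne : affineSimpleRoot b θ i ≠ affRoot P μ 0) {γ : ι} {k : ℤ}
    (hi : w⁻¹ (affineSimpleRoot b θ i) = affRoot P γ k) : 0 ≤ P.pairingIn ℤ γ θ := by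
  have h1 := form_simple_nonpos hθ hμ hne
  rw [h.form_inv_simple hi, neg_nonpos, ← not_lt, affineForm_neg_iff, not_lt] at h1
  exact h1

/-- For `α_i = μ` the inverse image is `2δ - θ`, where the sum in question is `2 - 2`. -/
theorem inv_ne_rootlet {i} {γ : ι} {k : ℤ}
    (hi : w⁻¹ (affineSimpleRoot b θ i) = affRoot P γ k) (hk : k + P.pairingIn ℤ γ θ ≠ 0) :
    affineSimpleRoot b θ i ≠ affRoot P μ 0 := by
  intro h1
  rw [h1, h.inv_rootlet, affRoot_ext_iff] at hi
  rw [← hi.1, ← hi.2, pairingIn_neg_index_left] at hk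
  simp at hk

theorem rootlet_simpleReflection_mul {i}
    (hi : affineForm P (affineSimpleRoot b θ i) (affRoot P μ 0) = 0) :
    (affineSimpleReflection b θ i * w) (affineSimpleRoot b θ none) + delta P = ofRoot P μ := by
  have hd := weyl_delta (simpleReflection_mem (b := b) (θ := θ) i)
  rw [LinearEquiv.mul_apply, ← congrArg (_ + ·) hd]
  rw [← map_add, h.rootlet, ofRoot_eq]
  exact simpleReflection_of_form_eq_zero (by rw [affineForm_comm, hi])

/-- `s_i` changes the sign of `±α_i` only, so left multiplication by it affects only the inversion
status of `±w⁻¹(α_i)`. -/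
theorem simpleReflection_mul_pos_iff (hθ : IsHighestRoot b θ) {i} {x : AffineSpan P}
    (hx : x ∈ affineRoots P)
    (h1 : x ≠ w⁻¹ (affineSimpleRoot b θ i)) (h2 : x ≠ -w⁻¹ (affineSimpleRoot b θ i)) :
    -((affineSimpleReflection b θ i * w) x) ∈ positiveAffineRoots b ↔
      -(w x) ∈ positiveAffineRoots b := by
  rw [LinearEquiv.mul_apply, ← map_neg]
  refine simpleReflection_pos_iff hθ (neg_mem_affineRoots (weyl_mem_affineRoots h.mem_weyl hx))
    (fun h3 => h2 ?_) fun h3 => h1 ?_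
  · rw [← h3, map_neg, weyl_inv_apply, neg_neg]
  · rw [← h3, neg_neg, weyl_inv_apply]

/-- `s_i w` no longer inverts `δ - γ = -w⁻¹(α_i)`, and the rootlet survives because `s_i` fixes `μ`.
The lemma `insert_of_inv_simple` is the opposite move. -/
theorem diff_singleton (hθ : IsHighestRoot b θ) {i} {γ : ι}
    (hi : w⁻¹ (affineSimpleRoot b θ i) = affRoot P γ (-1))
    (ho : affineForm P (affineSimpleRoot b θ i) (affRoot P μ 0) = 0) :
    IsMinusculeOver b θ μ (I \ {γ}) (affineSimpleReflection b θ i * w) := by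
  refine ⟨fun γ' hγ' => h.isPos γ' hγ'.1, ⟨mul_mem (simpleReflection_mem i) h.mem_weyl, ?_⟩,
    h.rootlet_simpleReflection_mul ho⟩
  have hneg : -w⁻¹ (affineSimpleRoot b θ i) = affRoot P (P.reflectionPerm γ γ) 1 := by
    rw [hi, neg_affRoot, neg_neg]
  have hnp : affRoot P γ (-1) ∉ positiveAffineRoots b := by
    rw [affRoot_mem_pos_iff]; omega
  ext x
  constructor
  · rintro ⟨h1, h2⟩
    by_cases hx : x = affRoot P (P.reflectionPerm γ γ) 1
    · rw [hx, ← hneg, LinearEquiv.mul_apply, map_neg, weyl_apply_inv, map_neg,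
        simpleReflection_self, neg_neg] at h2
      exact absurd h2 (not_neg_pos b (simple_pos b θ i))
    · rw [h.simpleReflection_mul_pos_iff hθ (pos_subset b h1) (fun h3 => hnp (hi ▸ h3 ▸ h1))
        (by rwa [hneg])] at h2
      obtain ⟨γ', h3, rfl⟩ := h.exists_of_neg h1 h2
      exact ⟨γ', ⟨h3, fun h4 => hx (by rw [h4])⟩, delta_sub_ofRoot γ'⟩
  · rintro ⟨γ', ⟨h1, h2⟩, rfl⟩
    simp only [delta_sub_ofRoot]
    have hp : affRoot P (P.reflectionPerm γ' γ') 1 ∈ positiveAffineRoots b :=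
      (affRoot_mem_pos_iff b).2 (.inl le_rfl)
    refine ⟨hp, ?_⟩
    rw [h.simpleReflection_mul_pos_iff hθ (affRoot_mem _ _) (fun h3 => hnp (hi ▸ h3 ▸ hp))]
    · exact (h.mem_iff γ').1 h1
    · rw [hneg, Ne, affRoot_ext_iff]
      rintro ⟨h3, -⟩
      exact h2 (by rw [Set.mem_singleton_iff, ← neg_neg_index (P := P) γ', h3, neg_neg_index])

theorem insert_of_inv_simple (hθ : IsHighestRoot b θ) {i} {γ : ι} (hγ : b.IsPos γ)
    (hi : w⁻¹ (affineSimpleRoot b θ i) = affRoot P (P.reflectionPerm γ γ) 1)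
    (ho : affineForm P (affineSimpleRoot b θ i) (affRoot P μ 0) = 0) :
    IsMinusculeOver b θ μ (insert γ I) (affineSimpleReflection b θ i * w) := by
  refine ⟨fun γ' hγ' => ?_, ⟨mul_mem (simpleReflection_mem i) h.mem_weyl, ?_⟩,
    h.rootlet_simpleReflection_mul ho⟩
  · rcases hγ' with rfl | hγ'
    exacts [hγ, h.isPos γ' hγ']
  have hinv : -((affineSimpleReflection b θ i * w) (affRoot P (P.reflectionPerm γ γ) 1)) ∈
      positiveAffineRoots b := by
    rw [← hi, LinearEquiv.mul_apply, weyl_apply_inv, simpleReflection_self, neg_neg]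
    exact simple_pos b θ i
  have hnp : -affRoot P (P.reflectionPerm γ γ) 1 ∉ positiveAffineRoots b := by
    rw [neg_affRoot, affRoot_mem_pos_iff]; omega
  ext x
  constructor
  · rintro ⟨h1, h2⟩
    by_cases hx : x = affRoot P (P.reflectionPerm γ γ) 1
    · exact ⟨γ, .inl rfl, by rw [hx]; exact delta_sub_ofRoot γ⟩
    · rw [h.simpleReflection_mul_pos_iff hθ (pos_subset b h1) (by rwa [hi])
        (fun h3 => hnp (hi ▸ h3 ▸ h1))] at h2
      obtain ⟨γ', h3, rfl⟩ := h.exists_of_neg h1 h2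
      exact ⟨γ', .inr h3, delta_sub_ofRoot γ'⟩
  · rintro ⟨γ', h1, rfl⟩
    simp only [delta_sub_ofRoot]
    have hp : affRoot P (P.reflectionPerm γ' γ') 1 ∈ positiveAffineRoots b :=
      (affRoot_mem_pos_iff b).2 (.inl le_rfl)
    refine ⟨hp, ?_⟩
    by_cases hγ' : γ' = γ
    · rw [hγ']; exact hinv
    · rw [h.simpleReflection_mul_pos_iff hθ (affRoot_mem _ _) _ (fun h3 => hnp (hi ▸ h3 ▸ hp))]
      · exact (h.mem_iff γ').1 (h1.resolve_left hγ')
      · rw [hi, Ne, affRoot_ext_iff]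
        rintro ⟨h3, -⟩
        exact hγ' (by rw [← neg_neg_index (P := P) γ', h3, neg_neg_index])

end IsMinusculeOver

end Minuscule

end AbelianIdealNormaliser

namespace AbelianIdealNormaliser

open RootPairing Module

/-! ### Extremal sets of roots with a fixed simple rootlet -/

section Extremal

variable {ι M N : Type*} [Fintype ι] [AddCommGroup M] [Module ℂ M] [AddCommGroup N] [Module ℂ N]
  {P : RootPairing ι ℂ M N} [P.IsCrystallographic] [P.IsRootSystem] [P.IsReduced]
  {b : P.Base} {θ μ : ι} {I : Set ι} {w : AffineSpan P ≃ₗ[ℝ] AffineSpan P}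

namespace IsMinusculeOver

variable (h : IsMinusculeOver b θ μ I w) (hθ : IsHighestRoot b θ) (hμ : μ ∈ b.support)

include h

theorem inv_mul_none {i} {γ : ι} {k : ℤ} (hi : w⁻¹ (affineSimpleRoot b θ i) = affRoot P γ k) :
    level P ((w * affineSimpleReflection b θ none)⁻¹ (affineSimpleRoot b θ i)) =
      k + P.pairingIn ℤ γ θ := by
  rw [mul_inv_rev, simpleReflection_inv, LinearEquiv.mul_apply, hi, simpleReflection_none_affRoot,
    level_affRoot, Int.cast_add]

theorem mul_none_mem : w * affineSimpleReflection b θ none ∈ affineWeylGroup b θ :=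
  mul_mem h.mem_weyl (simpleReflection_mem none)

theorem mul_none_apply_none : (w * affineSimpleReflection b θ none) (affineSimpleRoot b θ none) =
    affRoot P (P.reflectionPerm μ μ) 1 := by
  rw [LinearEquiv.mul_apply, simpleReflection_self, map_neg, h.apply_simple_none, neg_affRoot,
    neg_neg]

theorem mul_none_apply_of_pairingIn_eq_zero {γ : ι} (hγ : P.pairingIn ℤ γ θ = 0) (k : ℤ) :
    (w * affineSimpleReflection b θ none) (affRoot P γ k) = w (affRoot P γ k) := by
  rw [LinearEquiv.mul_apply, simpleReflection_of_form_eq_zero]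
  rw [affineSimpleRoot_none, affineForm_eq_zero_iff, pairingIn_neg_index_right, hγ, neg_zero]

/-! ### Minimal sets of roots with a given rootlet -/

section Minimal

variable (hmin : ∀ I' w', IsMinusculeOver b θ μ I' w' → I' ⊆ I → I' = I)

include hθ hmin

theorem inv_simple_pos_of_minimal {i} (ho : affineForm P (affineSimpleRoot b θ i)
    (affRoot P μ 0) = 0) : w⁻¹ (affineSimpleRoot b θ i) ∈ positiveAffineRoots b := by
  obtain ⟨γ, k, hi⟩ := h.exists_inv_simple i
  rw [hi]
  by_contra hn
  obtain ⟨h1, rfl⟩ := h.inv_simple_neg hi hn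
  have := hmin _ _ (h.diff_singleton hθ hi ho) Set.sdiff_subset
  rw [← this] at h1
  exact h1.2 rfl

include hμ

/-- Put `v = w s₀`. Each `v⁻¹(α_i)` has level `k + ⟨γ, θ^∨⟩ ≥ 0`: it is 0 for `α_i = μ`; otherwise
`⟨γ, θ^∨⟩ ≥ 0`, and when `k = -1` minimality excludes `⟨γ, θ^∨⟩ = 0`. So `v⁻¹` sends positive roots
to nonnegative levels, and every inversion of `v` has level 0. -/
theorem level_mul_none_of_minimal (γ : ι) (k : ℤ) :
    level P ((w * affineSimpleReflection b θ none) (affRoot P γ k)) = k := by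
  refine level_weyl_of_inversions hθ h.mul_none_mem (fun γ k hp hn => ?_) γ k
  set v := w * affineSimpleReflection b θ none
  let φ : AffineSpan P →ₗ[ℝ] ℝ := (level P).comp (v⁻¹ : AffineSpan P ≃ₗ[ℝ] AffineSpan P).toLinearMap
  have hφ : ∀ i, 0 ≤ φ (affineSimpleRoot b θ i) := by
    intro i
    obtain ⟨β, m, hi⟩ := h.exists_inv_simple i
    have h1 : φ (affineSimpleRoot b θ i) = ((m + P.pairingIn ℤ β θ : ℤ) : ℝ) := by
      push_cast
      exact h.inv_mul_none hi
    rw [h1]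
    refine Int.cast_nonneg ?_
    by_cases hne : m + P.pairingIn ℤ β θ = 0
    · exact hne.ge
    have h2 := h.pairingIn_nonneg hθ hμ (h.inv_ne_rootlet hi hne) hi
    by_cases h3 : affRoot P β m ∈ positiveAffineRoots b
    · rw [affRoot_mem_pos_iff] at h3
      omega
    · have h4 := (h.inv_simple_neg hi h3).2
      have h5 : P.pairingIn ℤ β θ ≠ 0 := fun h0 => h3 (by
        rw [← hi]
        exact h.inv_simple_pos_of_minimal hθ hmin ((h.form_simple_eq_zero_iff hi).2 h0))
      omega
  have h1 := nonneg_of_mem_cone hφ (pos_mem_cone hθ hn)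
  have h2 : φ (-(v (affRoot P γ k))) = ((-k : ℤ) : ℝ) := by
    simp [φ]
  rw [h2, Int.cast_nonneg_iff] at h1
  rw [affRoot_mem_pos_iff] at hp
  omega

theorem level_inv_mul_none_of_minimal (γ : ι) (k : ℤ) :
    level P ((w * affineSimpleReflection b θ none)⁻¹ (affRoot P γ k)) = k := by
  obtain ⟨β, m, hβ⟩ := weyl_mem_affineRoots (inv_mem h.mul_none_mem) (affRoot_mem γ k)
  rw [hβ, level_affRoot, ← h.level_mul_none_of_minimal hθ hμ hmin β m, ← hβ, weyl_apply_inv,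
    level_affRoot]

theorem add_pairingIn_of_minimal {i} {γ : ι} {k : ℤ}
    (hi : w⁻¹ (affineSimpleRoot b θ i) = affRoot P γ k) :
    ((k + P.pairingIn ℤ γ θ : ℤ) : ℝ) = level P (affineSimpleRoot b θ i) := by
  obtain ⟨β, m, hβ⟩ := simple_mem_affineRoots b θ i
  rw [Int.cast_add, ← h.inv_mul_none hi, hβ, h.level_inv_mul_none_of_minimal hθ hμ hmin,
    level_affRoot]

/-- The quotient `z = (w s₀)⁻¹ (w' s₀)` preserves levels and fixes `α₀` and `θ`. If `z(α_j) = γ`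
were negative, `(α_j, θ) = (γ, θ)` would be both nonnegative and nonpositive, hence 0. Then `s₀`
fixes both roots and `w'(α_j) = w(γ)`, although `w` and `w'` keep finite positive roots positive. -/
theorem eq_of_minimal {I' : Set ι} {w' : AffineSpan P ≃ₗ[ℝ] AffineSpan P}
    (h' : IsMinusculeOver b θ μ I' w')
    (hmin' : ∀ J x, IsMinusculeOver b θ μ J x → J ⊆ I' → J = I') : w = w' := by
  set s := affineSimpleReflection b θ none with hs
  have hz : (w * s)⁻¹ * (w' * s) ∈ affineWeylGroup b θ :=
    mul_mem (inv_mem h.mul_none_mem) h'.mul_none_mem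
  have hz0 : ((w * s)⁻¹ * (w' * s)) (affineSimpleRoot b θ none) = affineSimpleRoot b θ none := by
    rw [LinearEquiv.mul_apply, h'.mul_none_apply_none, ← h.mul_none_apply_none, weyl_inv_apply]
  have hzθ : ((w * s)⁻¹ * (w' * s)) (affRoot P θ 0) = affRoot P θ 0 := by
    rw [eq_sub_of_add_eq' (delta_eq b θ).symm, map_sub, hz0, weyl_delta hz]
  suffices (w * s)⁻¹ * (w' * s) = 1 by
    exact mul_right_cancel (inv_mul_eq_one.1 this)
  refine eq_one_of_forall_simple_pos hθ hz fun i => ?_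
  cases i with
  | none => rw [hz0]; exact simple_pos b θ none
  | some j =>
    rw [affineSimpleRoot_some]
    obtain ⟨γ, k, hj⟩ := weyl_mem_affineRoots hz (affRoot_mem (j : ι) 0)
    have hj' : (w' * s) (affRoot P j 0) = (w * s) (affRoot P γ k) := by
      rw [← hj, LinearEquiv.mul_apply ((w * s)⁻¹), weyl_apply_inv]
    have hk : k = 0 := by
      have h1 := h.level_mul_none_of_minimal hθ hμ hmin γ k
      rw [← hs, ← hj',
        h'.level_mul_none_of_minimal hθ hμ hmin'] at h1
      exact_mod_cast h1.symm
    subst hk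
    rw [hj]
    by_contra hn
    have hn' : b.IsPos (P.reflectionPerm γ γ) := by
      rw [isPos_neg_iff]
      exact fun hp => hn ((affRoot_mem_pos_iff b).2 (.inr ⟨rfl, hp⟩))
    have hjpos : b.IsPos j := Base.isPos_of_mem_support j.2
    have h1 := pairingIn_highest_nonneg hθ hjpos
    have h2 := pairingIn_highest_nonneg hθ hn'
    rw [pairingIn_neg_index_left] at h2
    have h3 : affineForm P (affRoot P j 0) (affRoot P θ 0) =
        affineForm P (affRoot P γ 0) (affRoot P θ 0) := by
      rw [← weyl_form hz, hj, hzθ]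
    have h4 := affineForm_pos_iff (P := P) (γ := (j : ι)) (β := θ) 0 0
    rw [h3, affineForm_pos_iff] at h4
    have h5 : P.pairingIn ℤ j θ = 0 := by omega
    have h6 : P.pairingIn ℤ γ θ = 0 := by
      rw [← affineForm_eq_zero_iff (P := P) 0 0, h3, affineForm_eq_zero_iff] at h5
      exact h5
    have h7 : w' (affRoot P j 0) = w (affRoot P γ 0) := by
      rw [← h'.mul_none_apply_of_pairingIn_eq_zero h5, ← h.mul_none_apply_of_pairingIn_eq_zero h6,
        ← hs, hj']
    have h8 := h.pos_of_isPos hn'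
    rw [show affRoot P (P.reflectionPerm γ γ) 0 = -affRoot P γ 0 by rw [neg_affRoot, neg_zero],
      map_neg, ← h7] at h8
    exact not_neg_pos b (h'.pos_of_isPos hjpos) h8

end Minimal

/-! ### Maximal sets of roots with a given rootlet -/

/-- The alcove of a minuscule element lies in the second dilate of the fundamental alcove. -/
theorem inv_simple_pos (hθ : IsHighestRoot b θ) {i}
    (hi : w⁻¹ (affineSimpleRoot b θ i) ∈ positiveAffineRoots b)
    (hne : affineSimpleRoot b θ i ≠ affRoot P μ 0) (hμ : μ ∈ b.support) :
    (∃ β ∈ b.support, w⁻¹ (affineSimpleRoot b θ i) = affRoot P β 0) ∨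
      ∃ γ, b.IsPos γ ∧ w⁻¹ (affineSimpleRoot b θ i) = affRoot P (P.reflectionPerm γ γ) 1 := by
  obtain ⟨γ, k, hx⟩ := h.exists_inv_simple i
  have hwx : w (affRoot P γ k) = affineSimpleRoot b θ i := by rw [← hx, weyl_apply_inv]
  have hd : ∀ n : ℕ, n • delta P ∈ simpleCone b θ := fun n => nsmul_mem (delta_mem_cone hθ) n
  rw [hx] at hi ⊢
  rw [affRoot_mem_pos_iff] at hi
  by_cases hγ : b.IsPos γ
  · obtain rfl : k = 0 := by
      by_contra hk
      have hk : 1 ≤ k := by omega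
      lift k to ℕ using by omega
      have h1 : affRoot P γ k = affRoot P γ 0 + k • delta P := by simp [affRoot]
      rw [h1, map_add, map_nsmul, weyl_delta h.mem_weyl] at hwx
      rcases eq_zero_or_eq_zero_of_add_eq_simple b θ (pos_mem_cone hθ (h.pos_of_isPos hγ)) (hd k)
        hwx with h2 | h2
      · rw [LinearEquiv.map_eq_zero_iff] at h2
        exact affRoot_ne_zero _ _ h2
      · have := congrArg (level P) h2
        rw [map_nsmul, level_delta, map_zero] at this
        simp at this
        omega
    left
    obtain ⟨j, hj, hp⟩ := hγ.exists_mem_support_pos_pairingIn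
    by_cases hjγ : γ = j
    · exact ⟨j, hj, by rw [hjγ]⟩
    rw [P.zero_lt_pairingIn_iff'] at hp
    obtain ⟨γ', hγ'⟩ := P.root_sub_root_mem_of_pairingIn_pos hp hjγ
    have h1 : affRoot P γ (0 + 0) = affRoot P γ' 0 + affRoot P j 0 :=
      affRoot_add_of_root_eq (by rw [hγ', sub_add_cancel]) 0 0
    rw [add_zero] at h1
    rw [h1, map_add] at hwx
    exact absurd hwx (pos_add_ne_simple hθ (h.pos_of_isPos (hγ.sub hj hγ'))
      (h.pos_of_isPos (Base.isPos_of_mem_support hj)) i)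
  · have hk : 1 ≤ k := by tauto
    have hγ' := (isPos_neg_iff b γ).2 hγ
    by_cases hk1 : k = 1
    · exact .inr ⟨_, hγ', by rw [neg_neg_index, hk1]⟩
    exfalso
    obtain ⟨n, rfl⟩ : ∃ n : ℕ, k = n + 2 := ⟨(k - 2).toNat, by omega⟩
    -- The last summand `2δ - θ` is sent to the simple root `μ`, so `α_i` would be `μ` plus an
    -- element of the cone; indecomposability then gives `α_i = μ`.
    have h1 : affRoot P γ (n + 2) = (affRoot P θ 0 - affRoot P (P.reflectionPerm γ γ) 0) +
        n • delta P + affRoot P (P.reflectionPerm θ θ) 2 := by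
      refine Prod.ext (Subtype.ext ?_) (Prod.ext ?_ ?_) <;> simp [delta, add_comm]
    have h2 : w (affRoot P θ 0 - affRoot P (P.reflectionPerm γ γ) 0) ∈ simpleCone b θ :=
      sub_mem_of_rootLE b (S := (simpleCone b θ).comap (w : AffineSpan P →+ AffineSpan P))
        (fun j hj => pos_mem_cone hθ (h.pos_of_isPos (Base.isPos_of_mem_support hj)))
        (hθ (P.reflectionPerm γ γ)) 0
    rw [h1, map_add, map_add, map_nsmul, weyl_delta h.mem_weyl, ← h.inv_rootlet,
      weyl_apply_inv] at hwx
    rcases eq_zero_or_eq_zero_of_add_eq_simple b θ (add_mem h2 (hd n))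
      (support_mem_cone b θ μ hμ) hwx with h3 | h3
    · rw [h3, zero_add] at hwx
      exact hne hwx.symm
    · exact affRoot_ne_zero _ _ h3

/-- For a maximal set of roots with rootlet `μ` such that `α₀` and `μ` are orthogonal, there is a
simple root which is not orthogonal to `θ` and is sent to an affine simple root. -/
theorem exists_simple_of_maximal (hθ : IsHighestRoot b θ) (hμ : μ ∈ b.support)
    (hmax : ∀ I' w', IsMinusculeOver b θ μ I' w' → I ⊆ I' → I' = I)
    (ho : affineForm P (affineSimpleRoot b θ none) (affRoot P μ 0) = 0) :
    ∃ β ∈ b.support, 0 < P.pairingIn ℤ β θ ∧ ∃ i, w (affRoot P β 0) = affineSimpleRoot b θ i := by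
  -- Some `(w s₀)⁻¹(α_i)` has level at least 1: `δ` is fixed, has level 1 and is a nonnegative
  -- combination of the `α_i`.
  obtain ⟨i, γ, k, hx, hk⟩ : ∃ i γ k, w⁻¹ (affineSimpleRoot b θ i) = affRoot P γ k ∧
      1 ≤ k + P.pairingIn ℤ γ θ := by
    by_contra! hcon
    let φ : AffineSpan P →ₗ[ℝ] ℝ := -(level P).comp
      ((w * affineSimpleReflection b θ none)⁻¹ : AffineSpan P ≃ₗ[ℝ] AffineSpan P).toLinearMap
    have hφ : ∀ i, 0 ≤ φ (affineSimpleRoot b θ i) := by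
      intro i
      obtain ⟨γ, k, hx⟩ := h.exists_inv_simple i
      have h1 : φ (affineSimpleRoot b θ i) = ((-(k + P.pairingIn ℤ γ θ) : ℤ) : ℝ) := by
        push_cast
        exact congrArg _ (h.inv_mul_none hx)
      rw [h1, Int.cast_nonneg_iff]
      have := hcon i γ k hx
      omega
    have h1 := nonneg_of_mem_cone hφ (delta_mem_cone hθ)
    have h2 : φ (delta P) = -1 := by
      have := weyl_delta (inv_mem h.mul_none_mem)
      simp only [φ, LinearMap.neg_apply, LinearMap.comp_apply, LinearEquiv.coe_coe, this,
        level_delta]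
    linarith
  have hne := h.inv_ne_rootlet hx (by omega)
  have hp := h.pairingIn_nonneg hθ hμ hne hx
  -- If `α_i = w(δ - γ')` were orthogonal to `μ`, then `γ'` could be added to `I`, against
  -- maximality.
  have hmem : ∀ γ', b.IsPos γ' → affRoot P γ k = affRoot P (P.reflectionPerm γ' γ') 1 →
      P.pairingIn ℤ γ θ ≠ 0 := by
    intro γ' h1 h2 h0
    rw [h2] at hx
    have h3 := hmax _ _ (h.insert_of_inv_simple hθ h1 hx (by
      rw [h.form_simple_eq_zero_iff hx, pairingIn_neg_index_left, neg_eq_zero]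
      rwa [(affRoot_ext_iff.1 h2).1, pairingIn_neg_index_left, neg_eq_zero] at h0))
      (Set.subset_insert _ _)
    have h4 : γ' ∈ I := h3 ▸ Set.mem_insert γ' I
    rw [h.mem_iff, ← hx, weyl_apply_inv] at h4
    exact not_neg_pos b (simple_pos b θ i) h4
  by_cases hp0 : P.pairingIn ℤ γ θ = 0
  · exfalso
    have hpos : affRoot P γ k ∈ positiveAffineRoots b := by
      rw [affRoot_mem_pos_iff]
      omega
    rw [← hx] at hpos
    rcases h.inv_simple_pos hθ hpos hne hμ with ⟨β, hβ, h1⟩ | ⟨γ', h1, h2⟩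
    · rw [hx, affRoot_ext_iff] at h1
      omega
    · exact hmem γ' h1 (hx ▸ h2) hp0
  · have hi0 : ∃ j, i = some j := by
      cases i with
      | none => exact absurd ((h.form_simple_eq_zero_iff hx).1 ho) hp0
      | some j => exact ⟨j, rfl⟩
    obtain ⟨j, rfl⟩ := hi0
    -- Otherwise adding `w⁻¹(μ) = 2δ - θ` gives `α_j + μ = (k + 2)δ`. Comparing levels, `α_j + μ =
    -- 0`, which is absurd.
    have hγθ : γ ≠ θ := by
      rintro rfl
      have h1 : (k + 2) • delta P = affRoot P γ k + affRoot P (P.reflectionPerm γ γ) 2 := by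
        refine Prod.ext (Subtype.ext ?_) (Prod.ext ?_ ?_) <;> simp [delta]
      have h2 := congrArg w h1
      rw [map_add, ← hx, ← h.inv_rootlet, weyl_apply_inv, weyl_apply_inv, map_zsmul,
        weyl_delta h.mem_weyl] at h2
      have h3 := congrArg (level P) h2
      rw [map_zsmul, level_delta, map_add, level_affRoot, affineSimpleRoot_some,
        level_affRoot] at h3
      simp only [zsmul_eq_mul, mul_one, Int.cast_zero, add_zero] at h3
      have h4 : k + 2 = 0 := by exact_mod_cast h3
      rw [h4, zero_smul] at h2
      have h5 := eq_zero_of_add_eq_zero b γ (simple_mem_cone b γ _) (support_mem_cone b γ μ hμ)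
        h2.symm
      rw [affineSimpleRoot_some] at h5
      exact affRoot_ne_zero _ _ h5
    -- Now the pairing is 1, hence `k ≥ 0`, which rules out the negative case `k = -1`.
    have hp1 := pairingIn_highest_le_one hθ hγθ
    have hpos : w⁻¹ (affineSimpleRoot b θ (some j)) ∈ positiveAffineRoots b := by
      by_contra hn
      rw [hx] at hn
      have := (h.inv_simple_neg hx hn).2
      omega
    rcases h.inv_simple_pos hθ hpos hne hμ with ⟨β, hβ, h1⟩ | ⟨γ', h1, h2⟩
    · refine ⟨β, hβ, ?_, some j, by rw [← h1, weyl_apply_inv]⟩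
      rw [hx, affRoot_ext_iff] at h1
      rw [← h1.1]
      omega
    · rw [hx, affRoot_ext_iff] at h2
      have h3 := pairingIn_highest_nonneg hθ h1
      rw [h2.1, pairingIn_neg_index_left] at hp hp0
      omega

/-- If `α₀` and `μ` are not orthogonal, a minimal set of roots with rootlet `μ` is the only set of
roots with rootlet `μ` that contains it. -/
theorem eq_of_minimal_of_subset (hθ : IsHighestRoot b θ) (hμ : μ ∈ b.support)
    (hmin : ∀ I' w', IsMinusculeOver b θ μ I' w' → I' ⊆ I → I' = I)
    (ho : affineForm P (affineSimpleRoot b θ none) (affRoot P μ 0) ≠ 0)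
    {I' : Set ι} {w' : AffineSpan P ≃ₗ[ℝ] AffineSpan P}
    (h' : IsMinusculeOver b θ μ I' w') (hI : I ⊆ I') : w' = w := by
  refine mul_inv_eq_one.1 (eq_one_of_forall_simple_pos hθ
    (mul_mem h'.mem_weyl (inv_mem h.mem_weyl)) fun i => ?_)
  rw [LinearEquiv.mul_apply]
  by_cases hne : affineSimpleRoot b θ i = affRoot P μ 0
  · rw [hne, h.inv_rootlet, ← h'.inv_rootlet, weyl_apply_inv, ← hne]
    exact simple_pos b θ i
  obtain ⟨γ, k, hx⟩ := h.exists_inv_simple i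
  have h1 := h.pairingIn_nonneg hθ hμ hne hx
  have h2 := h.add_pairingIn_of_minimal hθ hμ hmin hx
  -- With level at most 0, `w⁻¹(α_i)` is either a finite positive root, which `w'` keeps positive,
  -- or `γ - δ` with `γ ∈ I ⊆ I'`, which `w'` makes positive. So `w' w⁻¹` inverts no simple root.
  have hk : k ≤ 0 := by
    cases i with
    | none =>
      have h3 := mt (h.form_simple_eq_zero_iff hx).2 ho
      rw [affineSimpleRoot_none, level_affRoot, Int.cast_inj] at h2
      omega
    | some j =>
      rw [affineSimpleRoot_some, level_affRoot, Int.cast_inj] at h2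
      omega
  rw [hx]
  by_cases hp : affRoot P γ k ∈ positiveAffineRoots b
  · exact h'.pos_of_level_ne_one hp (by omega)
  · obtain ⟨h3, rfl⟩ := h.inv_simple_neg hx hp
    have h4 := (h'.mem_iff γ).1 (hI h3)
    rwa [← map_neg, neg_affRoot, neg_neg_index] at h4

theorem eq_of_weyl_eq {I' : Set ι} (h' : IsMinusculeOver b θ μ I' w) : I = I' := by
  ext γ
  rw [h.mem_iff, h'.mem_iff]

theorem exists_minimal_subset : ∃ I₀ w₀, IsMinusculeOver b θ μ I₀ w₀ ∧ I₀ ⊆ I ∧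
    ∀ I' w', IsMinusculeOver b θ μ I' w' → I' ⊆ I₀ → I' = I₀ := by
  obtain ⟨I₀, h1, h2⟩ := (Set.toFinite {J | ∃ x, IsMinusculeOver b θ μ J x}).exists_le_minimal
    ⟨w, h⟩
  obtain ⟨w₀, h3⟩ := h2.prop
  exact ⟨I₀, w₀, h3, h1, fun I' w' h4 h5 => le_antisymm h5 (h2.2 ⟨w', h4⟩ h5)⟩

/-- Distinct extremal sets of roots with the same simple rootlet are distinguished by the simple
roots that their minuscule elements send to affine simple roots. -/
theorem exists_distinguishing_simple (hθ : IsHighestRoot b θ) (hμ : μ ∈ b.support)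
    (hmin : ∀ I' w', IsMinusculeOver b θ μ I' w' → I' ⊆ I → I' = I)
    {J : Set ι} {x : AffineSpan P ≃ₗ[ℝ] AffineSpan P} (hx : IsMinusculeOver b θ μ J x)
    (hmax : ∀ I' w', IsMinusculeOver b θ μ I' w' → J ⊆ I' → I' = J) (hne : I ≠ J) :
    ∃ β ∈ b.support, (∃ i, x (affRoot P β 0) = affineSimpleRoot b θ i) ∧
      ∀ i, w (affRoot P β 0) ≠ affineSimpleRoot b θ i := by
  -- Otherwise `J` contains a minimal set, which is `I` by uniqueness, and nothing lies strictly
  -- above `I`.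
  have ho : affineForm P (affineSimpleRoot b θ none) (affRoot P μ 0) = 0 := by
    by_contra ho
    obtain ⟨I₀, w₀, h0, hsub, hmin₀⟩ := hx.exists_minimal_subset
    obtain rfl := h.eq_of_minimal hθ hμ hmin h0 hmin₀
    obtain rfl := h.eq_of_weyl_eq h0
    obtain rfl := h.eq_of_minimal_of_subset hθ hμ hmin ho hx hsub
    exact hne (h.eq_of_weyl_eq hx)
  obtain ⟨β, hβ, hp, hi⟩ := hx.exists_simple_of_maximal hθ hμ hmax ho
  refine ⟨β, hβ, hi, fun i hi' => ?_⟩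
  have h1 : w⁻¹ (affineSimpleRoot b θ i) = affRoot P β 0 := by rw [← hi', weyl_inv_apply]
  have h2 := h.add_pairingIn_of_minimal hθ hμ hmin h1
  cases i with
  | none => exact hp.ne' ((h.form_simple_eq_zero_iff h1).1 ho)
  | some j =>
    rw [affineSimpleRoot_some, level_affRoot, Int.cast_inj] at h2
    omega

/-! ### Combinatorics of the corresponding ideals -/

/-- Apply `w` to `δ - ζ = (δ - γ) - β`: both terms on the right become negative. -/
theorem add_mem_of_isPos (hθ : IsHighestRoot b θ) {γ β ζ : ι} (hγ : γ ∈ I) (hβ : b.IsPos β)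
    (hζ : P.root ζ = P.root γ + P.root β) : ζ ∈ I := by
  have h1 : affRoot P (P.reflectionPerm γ γ) (1 + 0) =
      affRoot P (P.reflectionPerm ζ ζ) 1 + affRoot P β 0 :=
    affRoot_add_of_root_eq (by rw [root_neg_index, root_neg_index, hζ]; abel) 1 0
  rw [add_zero] at h1
  rw [h.mem_iff] at hγ ⊢
  have h2 : -(w (affRoot P (P.reflectionPerm ζ ζ) 1)) =
      -(w (affRoot P (P.reflectionPerm γ γ) 1)) + w (affRoot P β 0) := by
    rw [h1, map_add]; abel
  rw [h2]
  refine pos_add hθ hγ (h.pos_of_isPos hβ) ?_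
  rw [← h2]
  exact neg_mem_affineRoots (weyl_mem_affineRoots h.mem_weyl (affRoot_mem _ _))

/-- Otherwise `2δ - ζ` would be a sum of two inversions, hence an inversion, but all inversions have
level 1. -/
theorem add_not_root (hθ : IsHighestRoot b θ) {γ β ζ : ι} (hγ : γ ∈ I) (hβ : β ∈ I) :
    P.root ζ ≠ P.root γ + P.root β := by
  intro hζ
  have h1 : affRoot P (P.reflectionPerm ζ ζ) (1 + 1) =
      affRoot P (P.reflectionPerm γ γ) 1 + affRoot P (P.reflectionPerm β β) 1 :=
    affRoot_add_of_root_eq (by simp_rw [root_neg_index, hζ]; abel) 1 1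
  have hp : affRoot P (P.reflectionPerm ζ ζ) (1 + 1) ∈ positiveAffineRoots b :=
    (affRoot_mem_pos_iff b).2 (.inl (by norm_num))
  have h2 := h.pos_of_level_ne_one hp (by norm_num)
  rw [h.mem_iff] at hγ hβ
  refine not_neg_pos b h2 ?_
  have h3 : -(w (affRoot P (P.reflectionPerm ζ ζ) (1 + 1))) =
      -(w (affRoot P (P.reflectionPerm γ γ) 1)) + -(w (affRoot P (P.reflectionPerm β β) 1)) := by
    rw [h1, map_add]; abel
  rw [h3]
  refine pos_add hθ hγ hβ ?_
  rw [← h3]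
  exact neg_mem_affineRoots (weyl_mem_affineRoots h.mem_weyl (affRoot_mem _ _))

theorem notMem_of_apply_simple (hθ : IsHighestRoot b θ) {β : ι} {i}
    (hi : w (affRoot P β 0) = affineSimpleRoot b θ i) : β ∉ I := by
  intro hβ
  rw [h.mem_iff] at hβ
  have h1 : delta P = affRoot P (P.reflectionPerm β β) 1 + affRoot P β 0 := by
    refine Prod.ext (Subtype.ext ?_) (Prod.ext ?_ ?_) <;> simp [delta]
  have h2 := congrArg w h1
  rw [weyl_delta h.mem_weyl, map_add, hi] at h2
  have h3 : -(w (affRoot P (P.reflectionPerm β β) 1)) + delta P = affineSimpleRoot b θ i := by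
    rw [h2]; abel
  rcases eq_zero_or_eq_zero_of_add_eq_simple b θ (pos_mem_cone hθ hβ) (delta_mem_cone hθ) h3
    with h4 | h4
  · rw [neg_eq_zero, LinearEquiv.map_eq_zero_iff] at h4
    exact affRoot_ne_zero _ _ h4
  · have := congrArg (level P) h4
    simp at this

/-- If `w(δ - ζ)` were positive, `α_i = -w(δ - γ) + w(δ - ζ)` would be a sum of two positive roots.
-/
theorem sub_mem_of_apply_simple (hθ : IsHighestRoot b θ) {β : ι} {i}
    (hi : w (affRoot P β 0) = affineSimpleRoot b θ i) {γ ζ : ι} (hγ : γ ∈ I)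
    (hζ : P.root ζ = P.root γ - P.root β) : ζ ∈ I := by
  have h1 : affRoot P (P.reflectionPerm ζ ζ) (1 + 0) =
      affRoot P (P.reflectionPerm γ γ) 1 + affRoot P β 0 :=
    affRoot_add_of_root_eq (by rw [root_neg_index, root_neg_index, hζ]; abel) 1 0
  rw [add_zero] at h1
  rw [h.mem_iff] at hγ ⊢
  have hr := weyl_mem_affineRoots h.mem_weyl (affRoot_mem (P.reflectionPerm ζ ζ) 1)
  refine (pos_or_neg_pos b hr).resolve_left fun hp => ?_
  refine pos_add_ne_simple hθ hγ hp i ?_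
  rw [h1, map_add, hi]
  abel

/-- Choose `α_i` in the support of `w(β)` with positive inner product with it, and write `α_i = w(η
+ kδ)`. If `η ≠ β`, then `ζ = β - η` is a root with `w(ζ - kδ)` positive. As `β = (η + kδ) + (ζ -
kδ)` is simple, one summand is negative, so `η` or `ζ` lies in `I`; subtracting `β` puts `-ζ` or
`-η` in `I`, which contradicts the signs under `w`. If `η = β`, either `β ∈ I` or `α_i` is `w(β)`
plus a multiple of `δ`, which must vanish. -/
theorem exists_apply_simple (hθ : IsHighestRoot b θ) {β : ι} (hβ : β ∈ b.support) (hβI : β ∉ I)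
    (hsub : ∀ γ ∈ I, ∀ ζ, P.root ζ = P.root γ - P.root β → ζ ∈ I) :
    ∃ i, w (affRoot P β 0) = affineSimpleRoot b θ i := by
  have hpos := h.pos_of_isPos (Base.isPos_of_mem_support hβ)
  have h0 : 0 < affineForm P (w (affRoot P β 0)) (w (affRoot P β 0)) := by
    rw [weyl_form h.mem_weyl]
    exact affineForm_self_pos β 0
  obtain ⟨i, hi, hc⟩ := exists_simple_of_mem_cone (pos_mem_cone hθ hpos) h0
  refine ⟨i, ?_⟩
  by_contra hne
  obtain ⟨η, k, hη⟩ := h.exists_inv_simple i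
  have hwη : w (affRoot P η k) = affineSimpleRoot b θ i := by rw [← hη, weyl_apply_inv]
  rw [← hwη, weyl_form h.mem_weyl, affineForm_pos_iff] at hi
  by_cases hβη : β = η
  · subst hβη
    by_cases hp : affRoot P β k ∈ positiveAffineRoots b
    · have hk : 0 ≤ k := by rw [affRoot_mem_pos_iff] at hp; omega
      lift k to ℕ using hk
      have h1 : affRoot P β k = affRoot P β 0 + k • delta P := by simp [affRoot]
      have h2 : w (affRoot P β k) = w (affRoot P β 0) + k • delta P := by
        rw [h1, map_add, map_nsmul, weyl_delta h.mem_weyl]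
      rw [hwη] at h2
      rcases eq_zero_or_eq_zero_of_add_eq_simple b θ (pos_mem_cone hθ hpos)
        (nsmul_mem (delta_mem_cone hθ) k) h2.symm with h3 | h3
      · rw [LinearEquiv.map_eq_zero_iff] at h3
        exact affRoot_ne_zero _ _ h3
      · rw [h3, add_zero] at h2
        exact hne h2.symm
    · exact hβI (h.inv_simple_neg hη hp).1
  · obtain ⟨ζ, hζ⟩ := P.root_sub_root_mem_of_pairingIn_pos hi hβη
    have h1 : affRoot P β (k + -k) = affRoot P η k + affRoot P ζ (-k) :=
      affRoot_add_of_root_eq (by rw [hζ]; abel) k (-k)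
    rw [add_neg_cancel] at h1
    have h2 : w (affRoot P ζ (-k)) ∈ positiveAffineRoots b := by
      refine pos_of_mem_cone hθ (weyl_mem_affineRoots h.mem_weyl (affRoot_mem _ _)) ?_
      rwa [h1, map_add, hwη, add_sub_cancel_left] at hc
    by_cases hp : affRoot P η k ∈ positiveAffineRoots b
    · by_cases hq : affRoot P ζ (-k) ∈ positiveAffineRoots b
      · refine pos_add_ne_simple hθ hp hq (some ⟨β, hβ⟩) ?_
        rw [← h1, affineSimpleRoot_some]
      · rw [← neg_pos_iff b (affRoot_mem _ _)] at hq
        obtain ⟨γ, hγ, h3⟩ := h.exists_of_neg hq (by rwa [map_neg, neg_neg])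
        rw [neg_affRoot, affRoot_ext_iff] at h3
        have hζγ : ζ = γ := by rw [← neg_neg_index (P := P) ζ, h3.1, neg_neg_index]
        have h4 := hsub γ hγ (P.reflectionPerm η η) (by rw [root_neg_index, ← hζγ, hζ]; abel)
        rw [h.mem_iff, neg_neg_index, show (1 : ℤ) = k by omega, hwη] at h4
        exact not_neg_pos b (simple_pos b θ i) h4
    · obtain ⟨hηI, rfl⟩ := h.inv_simple_neg hη hp
      have h4 := hsub η hηI (P.reflectionPerm ζ ζ) (by rw [root_neg_index, hζ]; abel)
      rw [h.mem_iff, neg_neg_index] at h4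
      rw [neg_neg] at h2
      exact not_neg_pos b h2 h4

end IsMinusculeOver

end Extremal

end AbelianIdealNormaliser

namespace AbelianIdealNormaliser

open RootPairing Module LieAlgebra LieAlgebra.IsKilling LieModule

section Lie

variable {L : Type*} [LieRing L] [LieAlgebra ℂ L] [FiniteDimensional ℂ L] [LieAlgebra.IsSimple ℂ L]
  {H : LieSubalgebra ℂ L} [H.IsCartanSubalgebra]

/-! ### Brackets of root spaces -/

theorem lie_mem_rootSpace_or_eq_zero {γ β : H.root} {x y : L} (hx : x ∈ rootSpace H γ.1)
    (hy : y ∈ rootSpace H β.1) (hne : (rootSystem H).root γ ≠ -(rootSystem H).root β) :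
    (∃ ζ, (rootSystem H).root ζ = (rootSystem H).root γ + (rootSystem H).root β ∧
      ⁅x, y⁆ ∈ rootSpace H ζ.1) ∨ ⁅x, y⁆ = 0 := by
  have h := lie_mem_genWeightSpace_of_mem_genWeightSpace hx hy
  by_cases hb : genWeightSpace L ((γ.1 : H → ℂ) + (β.1 : H → ℂ)) = ⊥
  · rw [hb] at h
    exact .inr (by simpa using h)
  · let χ : Weight ℂ H L := ⟨_, hb⟩
    have hχ : χ.IsNonZero := fun h0 => hne (by
      ext t
      have := congrFun h0.eq t
      exact eq_neg_of_add_eq_zero_left this)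
    exact .inl ⟨⟨χ, by simpa using hχ⟩, by ext t; rfl, h⟩

/-- By `sl₂` theory: descend with `f` from a primitive vector at the top of the `α`-string to weight
`β`. Since `β - α` is still in the string, one more `f` does not kill the vector. -/
theorem exists_lie_ne_zero {α β : Weight ℂ H L} (hα : α.IsNonZero)
    (hne : rootSpace H ((β : H → ℂ) - α) ≠ ⊥) :
    ∃ f ∈ rootSpace H (-α : H → ℂ), ∃ y ∈ rootSpace H β, ⁅f, y⁆ ≠ 0 := by
  obtain ⟨x, hx, x_ne0⟩ := (chainTop α β).exists_ne_zero
  obtain ⟨h, e, f, isSl2, he, hf⟩ := exists_isSl2Triple_of_weight_isNonZero hα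
  obtain rfl := isSl2.h_eq_coroot hα he hf
  have prim : isSl2.HasPrimitiveVectorWith x (chainLength α β : ℂ) :=
    have := lie_mem_genWeightSpace_of_mem_genWeightSpace he hx
    ⟨x_ne0, (chainLength_smul _ _ hx).symm, by rwa [genWeightSpace_add_chainTop _ _ hα] at this⟩
  have h1 : 1 ≤ chainBotCoeff α β := by
    have := (rootSpace_zsmul_add_ne_bot_iff α β hα (-1)).1 (by
      rwa [neg_one_zsmul, neg_add_eq_sub])
    have := this.2
    omega
  have h2 := chainBotCoeff_add_chainTopCoeff α β
  have h3 := prim.pow_toEnd_f_ne_zero_of_eq_nat rfl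
    (show chainTopCoeff α β + 1 ≤ chainLength α β by omega)
  refine ⟨f, hf, _, ?_, by rwa [pow_succ', Module.End.mul_apply] at h3⟩
  have h4 := toEnd_pow_apply_mem hf hx (chainTopCoeff α β)
  convert h4 using 2
  rw [coe_chainTop]
  simp

theorem rootSpace_le_of_mem {a : Submodule ℂ L} {γ : H.root} {x : L} (hx : x ∈ rootSpace H γ.1)
    (hx0 : x ≠ 0) (hxa : x ∈ a) : (rootSpace H γ.1).toSubmodule ≤ a := by
  intro y hy
  obtain ⟨c, hc⟩ := (finrank_eq_one_iff_of_nonzero' (⟨x, hx⟩ : rootSpace H γ.1)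
    (by simpa using hx0)).mp (finrank_rootSpace_eq_one γ.1 (LieSubalgebra.isNonZero_coe_root γ)) ⟨y, hy⟩
  have : c • x = y := congrArg Subtype.val hc
  rw [← this]
  exact a.smul_mem c hxa

theorem disjoint_rootSpace (χ : Weight ℂ H L) (s : Set (Weight ℂ H L)) (hχ : χ ∉ s) :
    Disjoint (genWeightSpace L χ).toSubmodule (⨆ ψ ∈ s, (genWeightSpace L ψ).toSubmodule) := by
  have h := LieSubmodule.iSupIndep_toSubmodule.2 (iSupIndep_genWeightSpace' ℂ H L)
  exact (h χ).mono_right (iSup₂_le fun ψ hψ => le_iSup₂_of_le (f := fun ψ (_ : ψ ≠ χ) =>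
    (genWeightSpace L ψ).toSubmodule) ψ (fun h => hχ (h ▸ hψ)) le_rfl)

/-! ### Abelian ideals and sets of roots -/

/-- The sum of the root spaces of the roots in `I`. -/
noncomputable def rootSum (I : Set H.root) : Submodule ℂ L := ⨆ γ ∈ I, (rootSpace H γ.1).toSubmodule

theorem rootSpace_le_rootSum {I : Set H.root} {γ : H.root} (hγ : γ ∈ I) :
    (rootSpace H γ.1).toSubmodule ≤ rootSum I :=
  le_iSup₂_of_le γ hγ le_rfl

theorem disjoint_rootSum {I : Set H.root} {γ : H.root} (hγ : γ ∉ I) :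
    Disjoint (rootSpace H γ.1).toSubmodule (rootSum I) := by
  refine (disjoint_rootSpace γ.1 (Subtype.val '' I) ?_).mono_right ?_
  · rintro ⟨β, hβ, h⟩
    exact hγ (Subtype.ext h ▸ hβ)
  · exact iSup₂_le fun β hβ => le_iSup₂_of_le (f := fun ψ (_ : ψ ∈ Subtype.val '' I) =>
      (genWeightSpace L (ψ : Weight ℂ H L)).toSubmodule) β.1 ⟨β, hβ, rfl⟩ le_rfl

theorem exists_ne_zero_mem_rootSpace (γ : H.root) : ∃ x ∈ rootSpace H γ.1, x ≠ 0 :=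
  γ.1.exists_ne_zero

variable {b : (rootSystem H).Base}

theorem cartan_le_borel {x : L} (hx : x ∈ H) : x ∈ borel b :=
  (le_sup_left : H.toSubmodule ≤ borel b) hx

theorem rootSpace_le_borel {γ : H.root} (hγ : b.IsPos γ) :
    (rootSpace H γ.1).toSubmodule ≤ borel b :=
  le_sup_of_le_right (le_iSup_of_le (⟨γ, hγ⟩ : {γ : H.root // b.IsPos γ}) le_rfl)

theorem rootsOf_rootSum {I : Set H.root} (hI : ∀ γ ∈ I, b.IsPos γ) :
    rootsOf b (rootSum I) = I := by
  ext γ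
  refine ⟨fun ⟨_, h⟩ => ?_, fun h => ⟨hI γ h, rootSpace_le_rootSum h⟩⟩
  by_contra hγ
  obtain ⟨x, hx, hx0⟩ := exists_ne_zero_mem_rootSpace γ
  exact hx0 (Submodule.disjoint_def.1 (disjoint_rootSum hγ) x hx (h hx))

theorem isAbelianIdeal_rootSum {I : Set H.root} (hI : ∀ γ ∈ I, b.IsPos γ)
    (hadd : ∀ γ ∈ I, ∀ β, b.IsPos β → ∀ ζ,
      (rootSystem H).root ζ = (rootSystem H).root γ + (rootSystem H).root β → ζ ∈ I)
    (hab : ∀ γ ∈ I, ∀ β ∈ I, ∀ ζ,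
      (rootSystem H).root ζ ≠ (rootSystem H).root γ + (rootSystem H).root β) :
    IsAbelianIdeal b (rootSum I) := by
  have hne : ∀ γ β, b.IsPos γ → b.IsPos β →
      (rootSystem H).root γ ≠ -(rootSystem H).root β := by
    intro γ β hγ hβ h
    rw [← root_neg_index, EmbeddingLike.apply_eq_iff_eq] at h
    rw [h, isPos_neg_iff] at hγ
    exact hγ hβ
  refine ⟨iSup₂_le fun γ hγ => rootSpace_le_borel (hI γ hγ), fun x hx y hy => ?_,
    fun x hx y hy => ?_⟩
  · suffices h : rootSum I ≤ (rootSum I).comap (toEnd ℂ L L x) from h hy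
    refine iSup₂_le fun γ hγ y hy => ?_
    suffices h : borel b ≤ (rootSum I).comap (toEnd ℂ L L y) by
      have h1 : ⁅y, x⁆ ∈ rootSum I := h hx
      rw [← lie_skew, neg_mem_iff] at h1
      exact h1
    refine sup_le (fun t ht => ?_) (iSup_le fun β t ht => ?_)
    · have h1 := lie_eq_smul_of_mem_rootSpace hy ⟨t, ht⟩
      have h2 : ⁅t, y⁆ ∈ rootSum I := by
        change ⁅t, y⁆ = _ at h1
        rw [h1]
        exact Submodule.smul_mem _ _ (rootSpace_le_rootSum hγ hy)
      rw [← lie_skew, neg_mem_iff] at h2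
      exact h2
    · change ⁅y, t⁆ ∈ rootSum I
      rcases lie_mem_rootSpace_or_eq_zero hy ht (hne _ _ (hI γ hγ) β.2) with ⟨ζ, h1, h2⟩ | h1
      · exact rootSpace_le_rootSum (hadd γ hγ β β.2 ζ h1) h2
      · rw [h1]; exact zero_mem _
  · suffices h : rootSum I ≤ LinearMap.ker (toEnd ℂ L L x) from h hy
    refine iSup₂_le fun γ hγ y hy => ?_
    suffices h : rootSum I ≤ LinearMap.ker (toEnd ℂ L L y) by
      have h1 : ⁅y, x⁆ = 0 := h hx
      rw [← lie_skew, neg_eq_zero] at h1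
      exact h1
    refine iSup₂_le fun β hβ t ht => ?_
    rcases lie_mem_rootSpace_or_eq_zero hy ht (hne _ _ (hI γ hγ) (hI β hβ)) with ⟨ζ, h1, -⟩ | h1
    · exact absurd h1 (hab γ hγ β hβ ζ)
    · exact h1

/-- For `e` in a positive root space, `[x, e] = γ(x)e` lies in `a`, so `0 = [x, [x, e]] = γ(x)² e`.
All weights thus vanish at `x`. -/
theorem eq_zero_of_mem_cartan {a : Submodule ℂ L} (ha : IsAbelianIdeal b a) {x : L} (hx : x ∈ H)
    (hxa : x ∈ a) : x = 0 := by
  have hpos : ∀ γ : H.root, b.IsPos γ → (γ.1 : H → ℂ) ⟨x, hx⟩ = 0 := by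
    intro γ hγ
    obtain ⟨e, he, he0⟩ := exists_ne_zero_mem_rootSpace γ
    have h1 : ⁅x, e⁆ = (γ.1 : H → ℂ) ⟨x, hx⟩ • e := lie_eq_smul_of_mem_rootSpace he ⟨x, hx⟩
    have h2 : ⁅x, e⁆ ∈ a := by
      rw [← lie_skew, neg_mem_iff]
      exact ha.lie_mem e (rootSpace_le_borel hγ he) x hxa
    have h3 := ha.lie_eq_zero x hxa _ h2
    rw [h1, lie_smul, h1, smul_smul, smul_eq_zero] at h3
    exact mul_self_eq_zero.1 (h3.resolve_right he0)
  have hall : ∀ χ : Weight ℂ H L, χ ⟨x, hx⟩ = 0 := by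
    intro χ
    by_cases hχ : χ.IsZero
    · rw [hχ.eq, Pi.zero_apply]
    · let γ : H.root := ⟨χ, by simpa using hχ⟩
      by_cases hγ : b.IsPos γ
      · exact hpos γ hγ
      · have h1 := hpos _ ((isPos_neg_iff b γ).2 hγ)
        have h2 := LinearMap.congr_fun (root_neg_index (P := rootSystem H) γ) ⟨x, hx⟩
        have h3 : -(χ ⟨x, hx⟩) = 0 := h2.symm.trans h1
        exact neg_eq_zero.1 h3
  have h : (⟨x, hx⟩ : H) ∈ (⊥ : Submodule ℂ H) := by
    rw [← iInf_ker_weight_eq_bot (L := L), Submodule.mem_iInf]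
    exact hall
  exact congrArg Subtype.val ((Submodule.mem_bot ℂ).1 h)

theorem isPos_of_mem_borel {γ : H.root} {x : L} (hx : x ∈ rootSpace H γ.1) (hx0 : x ≠ 0)
    (hxb : x ∈ borel b) : b.IsPos γ := by
  by_contra hγ
  let s : Set (Weight ℂ H L) := {χ | χ.IsZero} ∪ Subtype.val '' {γ : H.root | b.IsPos γ}
  have hγs : γ.1 ∉ s := by
    rintro (h | ⟨β, hβ, h⟩)
    · exact LieSubalgebra.isNonZero_coe_root γ h
    · exact hγ (Subtype.ext h ▸ hβ)
  refine hx0 (Submodule.disjoint_def.1 (disjoint_rootSpace γ.1 s hγs) x hx ?_)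
  have hle : ∀ χ ∈ s, (genWeightSpace L χ).toSubmodule ≤
      ⨆ ψ ∈ s, (genWeightSpace L ψ).toSubmodule :=
    fun χ hχ => le_iSup₂_of_le (f := fun ψ (_ : ψ ∈ s) =>
      (genWeightSpace L ψ).toSubmodule) χ hχ le_rfl
  refine (sup_le (fun t ht => ?_) (iSup_le fun β => ?_) : borel b ≤ _) hxb
  · have h0 : t ∈ rootSpace H (0 : H → ℂ) := by
      rw [rootSpace_zero_eq]
      exact ht
    by_cases hb : genWeightSpace L (0 : H → ℂ) = ⊥
    · replace h0 : t ∈ genWeightSpace L (0 : H → ℂ) := h0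
      rw [hb] at h0
      rw [(LieSubmodule.mem_bot _).1 h0]
      exact zero_mem _
    · exact hle ⟨0, hb⟩ (.inl rfl) h0
  · exact hle β.1.1 (.inr ⟨β.1, β.2, rfl⟩)

/-- Being stable under `H`, `a` is the sum of its intersections with the weight spaces; the zero
weight contributes nothing and root spaces are one-dimensional. -/
theorem eq_rootSum {a : Submodule ℂ L} (ha : IsAbelianIdeal b a) :
    a = rootSum (rootsOf b a) := by
  refine le_antisymm ?_ (iSup₂_le fun γ hγ => hγ.2)
  let A : LieSubmodule ℂ H L :=
    { a with lie_mem := fun {x m} hm => ha.lie_mem x (cartan_le_borel x.2) m hm }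
  have hA := congrArg LieSubmodule.toSubmodule (eq_iSup_inf_genWeightSpace (N := A))
  rw [LieSubmodule.iSup_toSubmodule] at hA
  refine (le_of_eq hA : a ≤ _).trans (iSup_le fun χ x hx => ?_)
  have hxa : x ∈ a := hx.1
  have hxχ : x ∈ genWeightSpace L χ := hx.2
  by_cases hx0 : x = 0
  · rw [hx0]; exact zero_mem _
  by_cases hχ : χ.IsZero
  · have hxH : x ∈ rootSpace H (0 : H → ℂ) := hχ.eq ▸ hxχ
    rw [rootSpace_zero_eq] at hxH
    exact absurd (eq_zero_of_mem_cartan ha hxH hxa) hx0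
  · let γ : H.root := ⟨χ, by simpa using hχ⟩
    exact rootSpace_le_rootSum (I := rootsOf b a) (γ := γ)
      ⟨isPos_of_mem_borel (γ := γ) hxχ hx0 (ha.le_borel hxa),
        rootSpace_le_of_mem (γ := γ) hxχ hx0 hxa⟩ hxχ

/-! ### Simple roots of the normaliser -/

theorem rootSpace_neg_le_normaliser {I : Set H.root} {β : H.root} (hβ : β ∉ I)
    (hsub : ∀ γ ∈ I, ∀ ζ,
      (rootSystem H).root ζ = (rootSystem H).root γ - (rootSystem H).root β → ζ ∈ I) :
    (rootSpace H ((rootSystem H).reflectionPerm β β).1).toSubmodule ≤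
      (subspaceNormaliser (rootSum I)).toSubmodule := by
  intro x hx y hy
  suffices h : rootSum I ≤ (rootSum I).comap (toEnd ℂ L L x) from h hy
  refine iSup₂_le fun γ hγ y hy => ?_
  change ⁅x, y⁆ ∈ rootSum I
  have hne : (rootSystem H).root ((rootSystem H).reflectionPerm β β) ≠
      -(rootSystem H).root γ := by
    rw [root_neg_index, Ne, neg_inj, EmbeddingLike.apply_eq_iff_eq]
    exact fun h => hβ (h ▸ hγ)
  rcases lie_mem_rootSpace_or_eq_zero hx hy hne with ⟨ζ, h1, h2⟩ | h1
  · exact rootSpace_le_rootSum (hsub γ hγ ζ (by rw [h1, root_neg_index]; abel)) h2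
  · rw [h1]; exact zero_mem _

theorem coe_neg_index (β : H.root) :
    (((rootSystem H).reflectionPerm β β).1 : H → ℂ) = -(β.1 : H → ℂ) := by
  ext t
  exact LinearMap.congr_fun (root_neg_index (P := rootSystem H) β) t

/-- If `e ∈ g_β` were in `a`, then `h = [e, f]` would be too, and `[h, e] = 2e ≠ 0` contradicts
commutativity. -/
theorem notMem_of_rootSpace_neg_le {a : Submodule ℂ L} (ha : IsAbelianIdeal b a) {β : H.root}
    (h : (rootSpace H ((rootSystem H).reflectionPerm β β).1).toSubmodule ≤
      (subspaceNormaliser a).toSubmodule) : β ∉ rootsOf b a := by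
  rintro ⟨-, hβ⟩
  obtain ⟨t, e, f, isSl2, he, hf⟩ := exists_isSl2Triple_of_weight_isNonZero
    (LieSubalgebra.isNonZero_coe_root β)
  rw [← coe_neg_index] at hf
  have h1 : ⁅f, e⁆ ∈ a := h hf e (hβ he)
  rw [← lie_skew, isSl2.lie_e_f, neg_mem_iff] at h1
  have h2 := ha.lie_eq_zero _ h1 e (hβ he)
  rw [isSl2.lie_h_e_smul ℂ] at h2
  exact isSl2.e_ne_zero ((smul_eq_zero.1 h2).resolve_left two_ne_zero)

theorem sub_mem_rootsOf {a : Submodule ℂ L} {β : H.root} (hβ : β ∈ b.support)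
    (h : (rootSpace H ((rootSystem H).reflectionPerm β β).1).toSubmodule ≤
      (subspaceNormaliser a).toSubmodule) {γ ζ : H.root} (hγ : γ ∈ rootsOf b a)
    (hζ : (rootSystem H).root ζ = (rootSystem H).root γ - (rootSystem H).root β) :
    ζ ∈ rootsOf b a := by
  have hζ' : (ζ.1 : H → ℂ) = (γ.1 : H → ℂ) - β.1 := by
    ext t
    exact LinearMap.congr_fun hζ t
  obtain ⟨f, hf, y, hy, hfy⟩ := exists_lie_ne_zero (α := β.1) (β := γ.1)
    (LieSubalgebra.isNonZero_coe_root β)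
    (by rw [← hζ']; exact ζ.1.genWeightSpace_ne_bot)
  have h1 := lie_mem_genWeightSpace_of_mem_genWeightSpace hf hy
  rw [neg_add_eq_sub, ← hζ'] at h1
  rw [← coe_neg_index] at hf
  exact ⟨hγ.1.sub hβ hζ, rootSpace_le_of_mem h1 hfy (h hf y (hγ.2 hy))⟩

/-! ### Rootlets -/

variable {θ μ : H.root}

theorem exists_isMinusculeOver {a : Submodule ℂ L} (h : a ∈ rootletFibre b θ μ) :
    ∃ w, IsMinusculeOver b θ μ (rootsOf b a) w := by
  obtain ⟨-, -, w, h1, h2⟩ := h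
  exact ⟨w, fun γ hγ => hγ.1, h1, h2⟩

/-- This turns extremality among ideals into extremality among sets of roots, where the
combinatorial arguments take place. -/
theorem IsMinusculeOver.rootSum_mem {I : Set H.root} {w} (h : IsMinusculeOver b θ μ I w)
    (hθ : IsHighestRoot b θ) : rootSum I ∈ rootletFibre b θ μ := by
  refine ⟨isAbelianIdeal_rootSum h.isPos
    (fun γ hγ β hβ ζ hζ => h.add_mem_of_isPos hθ hγ hβ hζ)
    (fun γ hγ β hβ ζ => h.add_not_root hθ hγ hβ), fun h0 => ?_, w, ?_, h.rootlet⟩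
  · obtain ⟨x, hx, hx0⟩ := exists_ne_zero_mem_rootSpace θ
    have := rootSpace_le_rootSum h.theta_mem hx
    rw [h0] at this
    exact hx0 this
  · rw [rootsOf_rootSum h.isPos]
    exact h.minuscule

end Lie

end AbelianIdealNormaliser

/-! ### Comparison of the two normalisers -/

open AbelianIdealNormaliser in
theorem corollary3p6 {L : Type*} [LieRing L] [LieAlgebra ℂ L] [FiniteDimensional ℂ L]
    [LieAlgebra.IsSimple ℂ L] (H : LieSubalgebra ℂ L) [H.IsCartanSubalgebra]
    (b : (LieAlgebra.IsKilling.rootSystem H).Base)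
    (θ : H.root) (hθ : IsHighestRoot b θ)
    (α : H.root) (hα : α ∈ b.support)
    (hlong : IsLong (LieAlgebra.IsKilling.rootSystem H) α)
    (amin amax : Submodule ℂ L)
    (hmin : Minimal (· ∈ rootletFibre b θ α) amin)
    (hmax : Maximal (· ∈ rootletFibre b θ α) amax)
    (hne : rootsOf b amin ≠ rootsOf b amax) :
    subspaceNormaliser amin ≠ subspaceNormaliser amax := by
  obtain ⟨u, hu⟩ := exists_isMinusculeOver hmin.prop
  obtain ⟨w, hw⟩ := exists_isMinusculeOver hmax.prop
  have hamin := eq_rootSum hmin.prop.1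
  have hamax := eq_rootSum hmax.prop.1
  have hmin' : ∀ I' w', IsMinusculeOver b θ α I' w' → I' ⊆ rootsOf b amin →
      I' = rootsOf b amin := by
    intro I' w' h h'
    have hle : rootSum I' ≤ amin := iSup₂_le fun γ hγ => (h' hγ).2
    rw [← rootsOf_rootSum h.isPos, le_antisymm hle (hmin.2 (h.rootSum_mem hθ) hle)]
  have hmax' : ∀ I' w', IsMinusculeOver b θ α I' w' → rootsOf b amax ⊆ I' →
      I' = rootsOf b amax := by
    intro I' w' h h'
    have hle : amax ≤ rootSum I' := by
      rw [hamax]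
      exact iSup₂_le fun γ hγ => rootSpace_le_rootSum (h' hγ)
    rw [← rootsOf_rootSum h.isPos, le_antisymm hle (hmax.2 (h.rootSum_mem hθ) hle)]
  obtain ⟨β, hβ, ⟨i, hi⟩, hn⟩ := hu.exists_distinguishing_simple hθ hα hmin' hw hmax' hne
  intro heq
  -- `g_{-β}` normalises `amax`. If the normalisers agreed it would normalise `amin`, and `u(β)`
  -- would be affine simple, against the choice of `β`.
  have h1 := rootSpace_neg_le_normaliser (hw.notMem_of_apply_simple hθ hi)
    (fun γ hγ ζ hζ => hw.sub_mem_of_apply_simple hθ hi hγ hζ)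
  rw [← hamax, ← heq] at h1
  obtain ⟨j, hj⟩ := hu.exists_apply_simple hθ hβ (notMem_of_rootSpace_neg_le hmin.prop.1 h1)
    (fun γ hγ ζ hζ => sub_mem_rootsOf hβ h1 hγ hζ)
  exact hn j hj
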